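/- **Setting.** For integers $m_\theta,m_\varphi\ge 1$ put $m=m_\varphi(m_\theta-1)+1$ and, for $x\in[m]=\{0,\dots,m-1\}$, $$\theta(x)=\arccos\Big(\tfrac{2}{m_\theta}\big(\lfloor x/m_\varphi\rfloor+1\big)-1\Big),\qquad \varphi(x)=\pi\,\frac{x \bmod m_\varphi}{m_\varphi},$$ $|0_x\rangle=\cos\frac{\theta(x)}2|0\rangle+e^{i\varphi(x)}\sin\frac{\theta(x)}2|1\rangle$, $|1_x\rangle=\sin\frac{\theta(x)}2|0\rangle-e^{i\varphi(x)}\cos\frac{\theta(x)}2|1\rangle$, $V^x_a=|a_x\rangle\langle a_x|$. In a round of the protocol $\mathrm{QPV}^{\eta,f}_{m_{\theta\varphi}}$, with $m_{\theta\varphi}=(m,m_\theta,m_\varphi)$ and $f:\{0,1\}^n\times\{0,1\}^n\to[m]$, the verifiers choose $x,y\in\{0,1\}^n$ uniformly at random and measure their qubit in the basis $f(x,y)$, and the answers $a,b\in\{0,1,\perp\}$ are recorded as *Correct* ($a=b$ equals the verifiers' outcome), *Wrong* ($a=b$ is the opposite bit), *No photon* ($a=b=\perp$), or *Abort* ($a\ne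 b$). A *$q$-qubit strategy* consists of a pure state $|\psi\rangle$ of the verifiers' qubit and $q$ qubits for each of Alice and Bob; unitaries $U_A^x$, $U_B^y$ on the attackers' registers; for each $x$ (resp. $y$) a set of qubits that Alice (resp. Bob) keeps, the others being exchanged; and POVMs $\{A_a^{xy}\}$, $\{B_b^{xy}\}$ with outcomes in $\{0,1,\perp\}$ on the registers held after the exchange. The attackers *respond with probability $\eta$* if on every input $(x,y)$ both answer $\perp$ with probability $1-\eta$ and they never give different answers. Write $\mathrm V_{AB}$ for the verifiers' record under the attack, and $\mathrm V_P$ for their record with the honest prover, who receives the qubit with probability $\eta$, then errs with probability $p_{err}$, and answers $\perp$ otherwise. For a unit vector $\phi\in\mathbb C^2\otimes\mathcal H_A\otimes\mathcal H_B$ with $\mathcal H_A,\mathcal H_B$ of finite dimension, let $$\tilde p_\phi^{\,i,\eta,\xi}=\frac1\eta\,\sup\sum_{a\in\{0,1\}}\langle\phi|V_a^i\otimes A_a\otimes B_a|\phi\rangle$$ over all POVMs $\{A_a\},\{B_b\}$ with outcomes in $\{0,1,\perp\}$ such that $\langle\phi|\mathbb I\otimes A_a\otimes B_b|\phi\rangle\le\xi$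 for all $a\ne b$ and $(1-\eta)-\xi\le\langle\phi|\mathbb I\otimes A_\perp\otimes B_\perp|\phi\rangle\le(1-\eta)+\xi$ (the supremum is $0$ if there are none), and let $$\tilde w^{\xi}_{m_{\theta\varphi}}(\eta)=\sup_\phi\frac1m\sum_{i\in[m]}\tilde p_\phi^{\,i,\eta,\xi}$$ over all such $\phi$ of all dimensions; any other upper bound for these averages is at least this large. Let $\xi=0.005$, $\Delta=0.009$, and $\eta_{m_{\theta\varphi}}=\inf\{\eta\in(0,1]:\tilde w^\xi_{m_{\theta\varphi}}(\eta)+\Delta\le1\}$. **Theorem.** Let $(m_{\theta\varphi},\beta)$ be $((3,2,2),\,0.15)$ or $((5,3,2),\,0.13)$. Let $\eta\in(\eta_{m_{\theta\varphi}},1]$ and let $n,q\ge0$ be integers with $q\le\frac n2-5$. Then a uniformly random $f:\{0,1\}^n\times\{0,1\}^n\to[m]$ has the following property with probability at least $1-2^{-2^n}$: for every $q$-qubit strategy in which the attackers respond with probability $\eta$, $$\mathbb P[\mathrm V_{AB}\ne\text{Correct}\mid \mathrm V_{AB}\ne\text{No photon}]\ \ge\ \beta\,\big[1-(\tilde w^{\xi}_{m_{\theta\varphi}}(\eta)+\Delta)\big],$$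 and consequently, whenever $p_{err}<\beta\,[1-(\tilde w^{\xi}_{m_{\theta\varphi}}(\eta)+\Delta)]$, $$\mathbb P[\mathrm V_{AB}=\text{Correct}\mid \mathrm V_{AB}\ne\text{No photon}]\ <\ \mathbb P[\mathrm V_{P}=\text{Correct}\mid \mathrm V_{P}\ne\text{No photon}]=1-p_{err}.$$ -/

import Mathlib

open scoped Kronecker Matrix ComplexOrder

noncomputable section

namespace QPV

/-! ### The qubit bases -/

/-- The number of bases, `m = m_φ (m_θ - 1) + 1`. -/
def numBases (mθ mφ : ℕ) : ℕ := mφ * (mθ - 1) + 1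

/-- The polar angle `θ(x) = arccos ((2 / m_θ) (⌊x / m_φ⌋ + 1) - 1)`. -/
def theta (mθ mφ : ℕ) (x : Fin (numBases mθ mφ)) : ℝ :=
  Real.arccos (2 / (mθ : ℝ) * (((x.val / mφ : ℕ) : ℝ) + 1) - 1)

/-- The azimuth `φ(x) = π (x mod m_φ) / m_φ`. -/
def azimuth (mθ mφ : ℕ) (x : Fin (numBases mθ mφ)) : ℝ :=
  Real.pi * ((x.val % mφ : ℕ) : ℝ) / (mφ : ℝ)

/-- The basis vectors `|0_x⟩ = cos(θ/2)|0⟩ + e^{iφ} sin(θ/2)|1⟩` and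
`|1_x⟩ = sin(θ/2)|0⟩ - e^{iφ} cos(θ/2)|1⟩`. -/
def basisVec (mθ mφ : ℕ) (x : Fin (numBases mθ mφ)) (a : Fin 2) : Fin 2 → ℂ :=
  let c : ℂ := (Real.cos (theta mθ mφ x / 2) : ℂ)
  let s : ℂ := (Real.sin (theta mθ mφ x / 2) : ℂ)
  let ph : ℂ := Complex.exp (Complex.I * (azimuth mθ mφ x : ℂ))
  if a = 0 then ![c, ph * s] else ![s, -(ph * c)]

/-- The verifiers' projector `V_a^x = |a_x⟩⟨a_x|`. -/
def verifierProj (mθ mφ : ℕ) (x : Fin (numBases mθ mφ)) (a : Fin 2) :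
    Matrix (Fin 2) (Fin 2) ℂ :=
  Matrix.vecMulVec (basisVec mθ mφ x a) (star (basisVec mθ mφ x a))

/-! ### States, measurements and probabilities -/

/-- The answers `0`, `1`, and `⊥` (which is `none`). -/
abbrev Answer := Option (Fin 2)

/-- A POVM with outcomes in `{0, 1, ⊥}` on the space `ℂ^α`. -/
structure POVM (α : Type) [Fintype α] [DecidableEq α] where
  op : Answer → Matrix α α ℂ
  posSemidef : ∀ a, (op a).PosSemidef
  sum_eq_one : ∑ a, op a = 1

/-- `φ` is a unit vector. -/
def IsState {ι : Type} [Fintype ι] (φ : ι → ℂ) : Prop := star φ ⬝ᵥ φ = 1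

/-- `⟨φ|M|φ⟩` (for the positive semidefinite operators used below this number is real). -/
def expect {ι : Type} [Fintype ι] (φ : ι → ℂ) (M : Matrix ι ι ℂ) : ℝ :=
  (star φ ⬝ᵥ (M *ᵥ φ)).re

section SingleInput

variable {α β : Type} [Fintype α] [DecidableEq α] [Fintype β] [DecidableEq β]

/-- The probability that Alice answers `a` and Bob answers `b`. -/
def answerProb (φ : Fin 2 × (α × β) → ℂ) (A : POVM α) (B : POVM β) (a b : Answer) : ℝ :=
  expect φ ((1 : Matrix (Fin 2) (Fin 2) ℂ) ⊗ₖ (A.op a ⊗ₖ B.op b))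

/-- The probability that both answers equal the verifiers' outcome in basis `i`. -/
def correctProb (mθ mφ : ℕ) (i : Fin (numBases mθ mφ)) (φ : Fin 2 × (α × β) → ℂ)
    (A : POVM α) (B : POVM β) : ℝ :=
  ∑ a : Fin 2, expect φ (verifierProj mθ mφ i a ⊗ₖ (A.op (some a) ⊗ₖ B.op (some a)))

/-- The probability that both answers are the bit opposite to the verifiers' outcome. -/
def wrongProb (mθ mφ : ℕ) (i : Fin (numBases mθ mφ)) (φ : Fin 2 × (α × β) → ℂ)
    (A : POVM α) (B : POVM β) : ℝ :=
  ∑ a : Fin 2,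
    expect φ (verifierProj mθ mφ i a ⊗ₖ (A.op (some (1 - a)) ⊗ₖ B.op (some (1 - a))))

/-- The probability that both answers are `⊥`. -/
def noPhotonProb (φ : Fin 2 × (α × β) → ℂ) (A : POVM α) (B : POVM β) : ℝ :=
  answerProb φ A B none none

/-- The probability that the two answers differ. -/
def abortProb (φ : Fin 2 × (α × β) → ℂ) (A : POVM α) (B : POVM β) : ℝ :=
  ∑ a : Answer, ∑ b : Answer, if a ≠ b then answerProb φ A B a b else 0

/-- `(A, B)` answers `a ≠ b` with probability at most `ξ` for each such pair, and `⊥, ⊥` with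
probability in `[(1 - η) - ξ, (1 - η) + ξ]`. -/
def Admissible (η ξ : ℝ) (φ : Fin 2 × (α × β) → ℂ) (A : POVM α) (B : POVM β) : Prop :=
  (∀ a b : Answer, a ≠ b → answerProb φ A B a b ≤ ξ) ∧
    (1 - η) - ξ ≤ noPhotonProb φ A B ∧ noPhotonProb φ A B ≤ (1 - η) + ξ

/-- `p̃_φ^{i,η,ξ}`: `1/η` times the largest probability of being correct on input `i` with the
state `φ`, over all admissible pairs of POVMs (it is `0` if there is no such pair). -/
def pTilde (mθ mφ : ℕ) (η ξ : ℝ) (i : Fin (numBases mθ mφ)) (φ : Fin 2 × (α × β) → ℂ) : ℝ :=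
  1 / η * sSup {p : ℝ | ∃ (A : POVM α) (B : POVM β),
    Admissible η ξ φ A B ∧ p = correctProb mθ mφ i φ A B}

end SingleInput

/-- `w̃^ξ(η)`: the least upper bound of `(1/m) ∑_i p̃_φ^{i,η,ξ}` over all states `φ` of the verifiers'
qubit and two registers of arbitrary finite dimension. -/
def wTilde (mθ mφ : ℕ) (ξ η : ℝ) : ℝ :=
  sSup {r : ℝ | ∃ (α β : Type) (_ : Fintype α) (_ : DecidableEq α) (_ : Fintype β)
    (_ : DecidableEq β) (φ : Fin 2 × (α × β) → ℂ), IsState φ ∧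
      r = 1 / (numBases mθ mφ : ℝ) * ∑ i, pTilde mθ mφ η ξ i φ}

/-- The threshold transmission rate: the least `η` with `w̃^ξ(η) + Δ ≤ 1`. -/
def etaThreshold (mθ mφ : ℕ) (ξ Δ : ℝ) : ℝ :=
  sInf {η : ℝ | 0 < η ∧ η ≤ 1 ∧ wTilde mθ mφ ξ η + Δ ≤ 1}

/-! ### Attacks -/

/-- Bit strings of length `n`; also the labels of the computational basis of `n` qubits. -/
abbrev Bits (n : ℕ) := Fin n → Bool

/-- Labels of the computational basis of the qubits in `K`. -/
abbrev BitsIn {q : ℕ} (K : Finset (Fin q)) := {i : Fin q // i ∈ K} → Bool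

/-- Labels of the computational basis of the qubits outside `K`. -/
abbrev BitsOut {q : ℕ} (K : Finset (Fin q)) := {i : Fin q // ¬ i ∈ K} → Bool

/-- Reassembling a label of all `q` qubits from its parts inside and outside `K`. -/
def glue {q : ℕ} (K : Finset (Fin q)) (s : BitsIn K) (t : BitsOut K) : Bits q :=
  (Equiv.piEquivPiSubtypeProd (fun i => i ∈ K) (fun _ => Bool)).symm (s, t)

/-- A `q`-qubit strategy: a state of the verifiers' qubit and of `q` qubits for each attacker,
unitaries applied after the inputs `x` and `y` are received, the qubits that each attacker then keeps
(the others are sent to the partner), and the POVMs after the exchange. Alice measures the qubits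
she kept and those received from Bob; Bob measures those received from Alice and those he kept. -/
structure Strategy (n q : ℕ) where
  state : Fin 2 × (Bits q × Bits q) → ℂ
  isState : IsState state
  UA : Bits n → Matrix.unitaryGroup (Bits q) ℂ
  UB : Bits n → Matrix.unitaryGroup (Bits q) ℂ
  keepA : Bits n → Finset (Fin q)
  keepB : Bits n → Finset (Fin q)
  povmA : ∀ x y : Bits n, POVM (BitsIn (keepA x) × BitsOut (keepB y))
  povmB : ∀ x y : Bits n, POVM (BitsOut (keepA x) × BitsIn (keepB y))

namespace Strategy

variable {n q : ℕ}

/-- The state `(1 ⊗ U_A^x ⊗ U_B^y)|ψ⟩`. -/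
def evolved (S : Strategy n q) (x y : Bits n) : Fin 2 × (Bits q × Bits q) → ℂ :=
  ((1 : Matrix (Fin 2) (Fin 2) ℂ) ⊗ₖ
    ((S.UA x : Matrix (Bits q) (Bits q) ℂ) ⊗ₖ (S.UB y : Matrix (Bits q) (Bits q) ℂ))) *ᵥ S.state

/-- The same state, with the registers regrouped as they are held after the exchange. -/
def exchanged (S : Strategy n q) (x y : Bits n) :
    Fin 2 × ((BitsIn (S.keepA x) × BitsOut (S.keepB y)) ×
      (BitsOut (S.keepA x) × BitsIn (S.keepB y))) → ℂ :=
  fun z => S.evolved x y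
    (z.1, (glue (S.keepA x) z.2.1.1 z.2.2.1, glue (S.keepB y) z.2.2.2 z.2.1.2))

/-- On every input `(x, y)` the attackers respond with probability `η`: both answer `⊥` with
probability `1 - η`, and they never give different answers. -/
def RespondsWith (S : Strategy n q) (η : ℝ) : Prop :=
  ∀ x y : Bits n,
    noPhotonProb (S.exchanged x y) (S.povmA x y) (S.povmB x y) = 1 - η ∧
      abortProb (S.exchanged x y) (S.povmA x y) (S.povmB x y) = 0

end Strategy

/-! ### The verifiers' record of a round -/

/-- What the verifiers record. -/
inductive Outcome
  | correct
  | wrong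
  | noPhoton
  | abort

/-- The distribution of the verifiers' record for the attack `S`, with uniformly random `x`, `y`. -/
def attackProb (mθ mφ : ℕ) {n q : ℕ} (f : Bits n → Bits n → Fin (numBases mθ mφ))
    (S : Strategy n q) : Outcome → ℝ
  | .correct => 1 / 2 ^ (2 * n) * ∑ x : Bits n, ∑ y : Bits n,
      correctProb mθ mφ (f x y) (S.exchanged x y) (S.povmA x y) (S.povmB x y)
  | .wrong => 1 / 2 ^ (2 * n) * ∑ x : Bits n, ∑ y : Bits n,
      wrongProb mθ mφ (f x y) (S.exchanged x y) (S.povmA x y) (S.povmB x y)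
  | .noPhoton => 1 / 2 ^ (2 * n) * ∑ x : Bits n, ∑ y : Bits n,
      noPhotonProb (S.exchanged x y) (S.povmA x y) (S.povmB x y)
  | .abort => 1 / 2 ^ (2 * n) * ∑ x : Bits n, ∑ y : Bits n,
      abortProb (S.exchanged x y) (S.povmA x y) (S.povmB x y)

/-- The distribution of the verifiers' record for the honest prover, who receives the qubit with
probability `η` and then errs with probability `perr`. -/
def honestProb (η perr : ℝ) : Outcome → ℝ
  | .correct => η * (1 - perr)
  | .wrong => η * perr
  | .noPhoton => 1 - η
  | .abort => 0

/-- `P[V = Correct | V ≠ No photon]`. -/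
def condCorrect (P : Outcome → ℝ) : ℝ :=
  P .correct / (P .correct + P .wrong + P .abort)

/-- `P[V ≠ Correct | V ≠ No photon]`. -/
def condNotCorrect (P : Outcome → ℝ) : ℝ :=
  (P .wrong + P .abort) / (P .correct + P .wrong + P .abort)

/-- `β [1 - (w̃^ξ(η) + Δ)]`. -/
def errorBound (mθ mφ : ℕ) (β ξ Δ η : ℝ) : ℝ :=
  β * (1 - (wTilde mθ mφ ξ η + Δ))

end QPV

end

/-! The argument is a union bound over discretized attacks. Since `pTilde` takes a supremum over all
POVMs, measurements need no discretizing: an attack enters only through its shared state, its local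
unitaries and the sets of kept qubits. These are replaced by elements of finite nets
(`exists_state_net`, `exists_unitary_net_bits`, `Strategy.exists_rounding`). The resulting state
error is at most d = 2 · 0.00112 + 0.000007 = 0.002247, small enough that the POVMs of the attack
remain admissible for slack ξ = 0.005 and the probability of being correct changes by at most η Δ
(`correctProb_le_of_near`).

For a fixed rounding D and input (x, y), the minimum of `pTilde` over the bases is at most its
average, hence at most `wTilde`. So some basis t(D, x, y) is bad for every attack rounding to D:
there it is correct with probability at most η(w̃ + Δ), against the trivial bound η. If f agrees
with t(D, ·) on a fraction β of the inputs, averaging gives the error bound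
(`errorBound_le_of_hits`).

A random f agrees with a fixed t on a fraction 1/m > β on average, and a Chernoff bound makes fewer
than β 4^n agreements exponentially unlikely in 4^n. The roundings number about exp(2 · 2^n · 4^q ·
log 5611), because unitaries are chosen separately for each x and each y. With 4^q ≤ 2^n / 1024 the
Chernoff exponent wins (`count_mul_exp_le`).

The continuity estimate needs η ≥ 1/5. If η < 1/5, guessing the basis already gives w̃ ≥ 1
(`one_le_wTilde`). Whenever w̃ + Δ > 1 the claimed error bound is negative and holds trivially. -/

namespace QPV

/-! ### Finite nets for states and for unitaries up to phase. -/

section Nets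

open Metric Module MeasureTheory NormedSpace

/-- Volume comparison: the balls of radius ε/2 around the points are disjoint and lie in the ball of
radius R + ε/2. An arbitrary norm is allowed because the bound is also used in a quotient space. -/
theorem card_le_of_separated {E : Type*} [NormedAddCommGroup E] [NormedSpace ℝ E]
    [FiniteDimensional ℝ E] {R ε : ℝ} (hR : 0 ≤ R) (hε : 0 < ε) (s : Finset E)
    (hs : ∀ c ∈ s, ‖c‖ ≤ R) (h : ∀ c ∈ s, ∀ d ∈ s, c ≠ d → ε ≤ ‖c - d‖) :
    (s.card : ℝ) ≤ (1 + 2 * R / ε) ^ finrank ℝ E := by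
  borelize E
  let μ : Measure E := Measure.addHaar
  have hδ : 0 < ε / 2 := by positivity
  have hρ : 0 < R + ε / 2 := by positivity
  have D : Set.Pairwise (s : Set E) (Function.onFun Disjoint fun c => ball (c : E) (ε / 2)) := by
    rintro c hc d hd hcd
    apply ball_disjoint_ball
    rw [dist_eq_norm, add_halves]
    exact h c hc d hd hcd
  have A_subset : (⋃ c ∈ s, ball (c : E) (ε / 2)) ⊆ ball (0 : E) (R + ε / 2) := by
    refine Set.iUnion₂_subset fun x hx => ball_subset_ball' ?_
    rw [dist_zero_right, add_comm]
    gcongr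
    exact hs x hx
  have I : (s.card : ENNReal) * ENNReal.ofReal ((ε / 2) ^ finrank ℝ E) * μ (ball 0 1) ≤
      ENNReal.ofReal ((R + ε / 2) ^ finrank ℝ E) * μ (ball 0 1) :=
    calc
      _ = μ (⋃ c ∈ s, ball (c : E) (ε / 2)) := by
        rw [measure_biUnion_finset D fun c _ => measurableSet_ball]
        simp only [μ.addHaar_ball_of_pos _ hδ, Finset.sum_const, nsmul_eq_mul, mul_assoc]
      _ ≤ μ (ball (0 : E) (R + ε / 2)) := measure_mono A_subset
      _ = _ := by simp only [μ.addHaar_ball_of_pos _ hρ]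
  have J := (ENNReal.mul_le_mul_iff_left (measure_ball_pos μ _ zero_lt_one).ne'
    measure_ball_lt_top.ne).1 I
  have K := ENNReal.toReal_le_of_le_ofReal (pow_nonneg hρ.le _) J
  rw [ENNReal.toReal_mul, ENNReal.toReal_natCast, ENNReal.toReal_ofReal (by positivity)] at K
  rw [show 1 + 2 * R / ε = (R + ε / 2) / (ε / 2) by field_simp; ring, div_pow,
    le_div_iff₀ (by positivity)]
  exact K

/-- An ε-separated subset of maximal cardinality is a net, since a point far from all of it could be
added. -/
theorem exists_net {E : Type*} [NormedAddCommGroup E] [NormedSpace ℝ E]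
    [FiniteDimensional ℝ E] {R ε : ℝ} (hR : 0 ≤ R) (hε : 0 < ε) (A : Set E)
    (hA : ∀ x ∈ A, ‖x‖ ≤ R) :
    ∃ s : Finset E, (s : Set E) ⊆ A ∧ (s.card : ℝ) ≤ (1 + 2 * R / ε) ^ finrank ℝ E ∧
      ∀ x ∈ A, ∃ y ∈ s, ‖x - y‖ < ε := by
  classical
  let P : ℕ → Prop := fun k => ∃ s : Finset E, (s : Set E) ⊆ A ∧
    (∀ c ∈ s, ∀ d ∈ s, c ≠ d → ε ≤ ‖c - d‖) ∧ s.card = k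
  have hP0 : P 0 := ⟨∅, by simp, by simp, rfl⟩
  have hbound : ∀ k, P k → k ≤ ⌊(1 + 2 * R / ε) ^ finrank ℝ E⌋₊ := by
    rintro k ⟨s, hsA, hs, rfl⟩
    exact Nat.le_floor (card_le_of_separated hR hε s (fun c hc => hA c (hsA hc)) hs)
  obtain ⟨s, hsA, hs, hcard⟩ := Nat.findGreatest_spec (P := P) (hbound 0 hP0) hP0
  refine ⟨s, hsA, card_le_of_separated hR hε s (fun c hc => hA c (hsA hc)) hs, fun x hx => ?_⟩
  by_contra! hfar
  have hxs : x ∉ s := fun h => by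
    have := hfar x h
    simp only [sub_self, norm_zero] at this
    linarith
  have hP : P (s.card + 1) := by
    refine ⟨insert x s, ?_, ?_, Finset.card_insert_of_notMem hxs⟩
    · rw [Finset.coe_insert]
      exact Set.insert_subset hx hsA
    · intro c hc d hd hcd
      rcases Finset.mem_insert.1 hc with hcx | hcs <;>
        rcases Finset.mem_insert.1 hd with hdx | hds
      · exact absurd (hcx.trans hdx.symm) hcd
      · exact hcx ▸ hfar d hds
      · rw [norm_sub_rev]
        exact hdx ▸ hfar c hcs
      · exact hs c hcs d hds hcd
  have := Nat.le_findGreatest (hbound _ hP) hP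
  omega

open scoped Matrix.Norms.L2Operator in
-- The logarithm is `arg` applied by functional calculus; its discontinuity is harmless because the
-- spectrum of a matrix is finite.
theorem exists_selfAdjoint_exp_eq {ι : Type*} [Fintype ι] [DecidableEq ι]
    (U : Matrix.unitaryGroup ι ℂ) :
    ∃ H : selfAdjoint (Matrix ι ι ℂ), ‖H‖ ≤ Real.pi ∧
      NormedSpace.exp (Complex.I • (H : Matrix ι ι ℂ)) = U := by
  have hU : (U : Matrix ι ι ℂ) ∈ unitary (Matrix ι ι ℂ) := U.2
  have hcont : ∀ g : ℂ → ℂ, ContinuousOn g (spectrum ℂ (U : Matrix ι ι ℂ)) :=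
    fun g => (Matrix.finite_spectrum (U : Matrix ι ι ℂ)).continuousOn g
  have hn : IsStarNormal (U : Matrix ι ι ℂ) := isStarNormal_of_mem_unitary hU
  have hsa : IsSelfAdjoint (cfc (fun z : ℂ => (Complex.arg z : ℂ)) (U : Matrix ι ι ℂ)) :=
    IsSelfAdjoint.cfc_arg _
  refine ⟨⟨_, hsa⟩, ?_, ?_⟩
  · show ‖cfc (fun z : ℂ => (Complex.arg z : ℂ)) (U : Matrix ι ι ℂ)‖ ≤ Real.pi
    refine norm_cfc_le Real.pi_pos.le fun z _ => ?_
    simpa using Complex.abs_arg_le_pi z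
  · rw [← CFC.exp_eq_normedSpace_exp (𝕜 := ℂ), ← cfc_comp_smul .., 
      ← cfc_comp' (hf := hcont _)
        (hg := ((Matrix.finite_spectrum (U : Matrix ι ι ℂ)).image _).continuousOn _)]
    conv_rhs => rw [← cfc_id' ℂ (U : Matrix ι ι ℂ)]
    refine cfc_congr fun z hz ↦ ?_
    have hz1 : ‖z‖ = 1 := spectrum.norm_eq_one_of_unitary hU hz
    have := Complex.norm_mul_exp_arg_mul_I z
    rw [hz1, Complex.ofReal_one, one_mul] at this
    simp only [smul_eq_mul, mul_comm Complex.I, ← Complex.exp_eq_exp_ℂ, this]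

/-- With h = iH and k = iK, the path exp(th) exp((1 - t)k) joins the two exponentials. Its
derivative is h - k between two unitaries, so its speed is constantly ‖H - K‖, with no loss
depending on the dimension. -/
theorem norm_exp_sub_exp_le {A : Type*} [CStarAlgebra A] (H K : selfAdjoint A) :
    ‖NormedSpace.exp (Complex.I • (H : A)) - NormedSpace.exp (Complex.I • (K : A))‖ ≤
      ‖H - K‖ := by
  let h : A := Complex.I • (H : A)
  let k : A := Complex.I • (K : A)
  have hnorm : ∀ (X : selfAdjoint A) (t : ℝ) (a : A),
      ‖NormedSpace.exp (t • (Complex.I • (X : A))) * a‖ = ‖a‖ := by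
    intro X t a
    have : NormedSpace.exp (t • (Complex.I • (X : A))) ∈ unitary A := by
      have := (selfAdjoint.expUnitary (t • X)).2
      rwa [selfAdjoint.expUnitary_coe, selfAdjoint.val_smul, smul_comm] at this
    exact CStarRing.norm_mem_unitary_mul a this
  have hnorm' : ∀ (X : selfAdjoint A) (t : ℝ) (a : A),
      ‖a * NormedSpace.exp (t • (Complex.I • (X : A)))‖ = ‖a‖ := by
    intro X t a
    have : NormedSpace.exp (t • (Complex.I • (X : A))) ∈ unitary A := by
      have := (selfAdjoint.expUnitary (t • X)).2
      rwa [selfAdjoint.expUnitary_coe, selfAdjoint.val_smul, smul_comm] at this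
    exact CStarRing.norm_mul_mem_unitary a this
  let F : ℝ → A := fun t => NormedSpace.exp (t • h) * NormedSpace.exp ((1 - t) • k)
  have hF : ∀ t : ℝ, HasDerivAt F
      (NormedSpace.exp (t • h) * (h - k) * NormedSpace.exp ((1 - t) • k)) t := by
    intro t
    have h1 : HasDerivAt (fun t : ℝ => NormedSpace.exp (t • h))
      (NormedSpace.exp (t • h) * h) t := hasDerivAt_exp_smul_const h t
    have h2 : HasDerivAt (fun t : ℝ => NormedSpace.exp ((1 - t) • k))
        (-(k * NormedSpace.exp ((1 - t) • k))) t := by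
      have h3 : HasDerivAt (fun t : ℝ => (1 - t)) (-1) t := by
        simpa using (hasDerivAt_id t).const_sub 1
      have h4 := (hasDerivAt_exp_smul_const' k (1 - t)).scomp t h3
      simpa [Function.comp_def] using h4
    convert! h1.mul h2 using 1
    noncomm_ring
  have hmv := Convex.norm_image_sub_le_of_norm_hasDerivWithin_le (f := F) (C := ‖H - K‖)
    (s := Set.univ) (x := 0) (y := 1) (fun t _ => (hF t).hasDerivWithinAt) (fun t _ => ?_)
    convex_univ trivial trivial
  · simpa [F, h, k] using hmv
  · rw [hnorm', hnorm]
    show ‖Complex.I • (H : A) - Complex.I • (K : A)‖ ≤ _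
    rw [← smul_sub, norm_smul, Complex.norm_I, one_mul]
    rfl

instance finite_selfAdjoint_matrix (ι : Type*) [Fintype ι] :
    Module.Finite ℝ (selfAdjoint (Matrix ι ι ℂ)) :=
  Module.Finite.of_injective
    ({ toFun := fun a => a.1, map_add' := fun _ _ => rfl, map_smul' := fun _ _ => rfl } :
      selfAdjoint (Matrix ι ι ℂ) →ₗ[ℝ] Matrix ι ι ℂ) Subtype.val_injective

instance finite_skewAdjoint_matrix (ι : Type*) [Fintype ι] :
    Module.Finite ℝ (skewAdjoint (Matrix ι ι ℂ)) :=
  Module.Finite.of_injective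
    ({ toFun := fun a => a.1, map_add' := fun _ _ => rfl, map_smul' := fun _ _ => rfl } :
      skewAdjoint (Matrix ι ι ℂ) →ₗ[ℝ] Matrix ι ι ℂ) Subtype.val_injective

/-- Multiplication by i embeds the self-adjoint part in the skew-adjoint part, and the two real
dimensions add up to 2 · card². -/
theorem finrank_selfAdjoint_matrix_le (ι : Type*) [Fintype ι] [DecidableEq ι] :
    finrank ℝ (selfAdjoint (Matrix ι ι ℂ)) ≤ Fintype.card ι ^ 2 := by
  have h1 := (StarModule.decomposeProdAdjoint ℝ (Matrix ι ι ℂ)).finrank_eq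
  rw [Module.finrank_prod] at h1
  have h2 : finrank ℝ (selfAdjoint (Matrix ι ι ℂ)) ≤ finrank ℝ (skewAdjoint (Matrix ι ι ℂ)) := by
    let g : selfAdjoint (Matrix ι ι ℂ) →ₗ[ℝ] skewAdjoint (Matrix ι ι ℂ) :=
      { toFun := fun a => ⟨Complex.I • (a : Matrix ι ι ℂ),
          a.2.smul_mem_skewAdjoint Complex.conj_I⟩
        map_add' := fun a b => Subtype.ext (smul_add _ _ _)
        map_smul' := fun r a => Subtype.ext (smul_comm Complex.I r (a : Matrix ι ι ℂ)) }
    refine LinearMap.finrank_le_finrank_of_injective (f := g) fun a b hab => ?_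
    have : Complex.I • (a : Matrix ι ι ℂ) = Complex.I • (b : Matrix ι ι ℂ) := congrArg Subtype.val hab
    exact Subtype.ext (smul_right_injective _ Complex.I_ne_zero this)
  have h3 : finrank ℝ (Matrix ι ι ℂ) = 2 * Fintype.card ι ^ 2 := by
    rw [finrank_matrix, Complex.finrank_real_complex]; ring
  omega

open scoped Matrix.Norms.L2Operator in
-- Global phases do not affect probabilities, so the net is built on self-adjoint logarithms modulo
-- real multiples of the identity. This saves one real dimension, which the final count needs when q
-- is small.
theorem exists_unitary_net (ι : Type*) [Fintype ι] [DecidableEq ι] [Nonempty ι] {ε : ℝ}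
    (hε : 0 < ε) :
    ∃ s : Finset (Matrix.unitaryGroup ι ℂ),
      (s.card : ℝ) ≤ (1 + 2 * Real.pi / ε) ^ (Fintype.card ι ^ 2 - 1) ∧
      ∀ U : Matrix.unitaryGroup ι ℂ, ∃ V ∈ s, ∃ z : ℂ, ‖z‖ = 1 ∧
        ‖(U : Matrix ι ι ℂ) - z • (V : Matrix ι ι ℂ)‖ ≤ ε := by
  classical
  let S := selfAdjoint (Matrix ι ι ℂ)
  let T : Submodule ℝ S := Submodule.span ℝ {1}
  have : Module.Finite ℝ S := finite_selfAdjoint_matrix ι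
  have : IsClosed (T : Set S) := Submodule.closed_of_finiteDimensional T
  obtain ⟨s, hsA, hcard, hs⟩ := exists_net (E := S ⧸ T) Real.pi_pos.le hε
    (T.mkQ '' {H : S | ‖H‖ ≤ Real.pi}) (by
      rintro _ ⟨H, hH, rfl⟩
      exact (Submodule.Quotient.norm_mk_le T H).trans hH)
  have hlift : ∀ y : S ⧸ T, ∃ H : S, T.mkQ H = y := T.mkQ_surjective
  choose lift hlift using hlift
  have hone : (1 : S) ≠ 0 := fun h => one_ne_zero (α := Matrix ι ι ℂ) (congrArg Subtype.val h)
  have hrank : finrank ℝ (S ⧸ T) ≤ Fintype.card ι ^ 2 - 1 := by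
    have h1 := Submodule.finrank_quotient_add_finrank T
    have h2 : finrank ℝ T = 1 := finrank_span_singleton hone
    have h3 := finrank_selfAdjoint_matrix_le ι
    have h4 : finrank ℝ S = finrank ℝ (selfAdjoint (Matrix ι ι ℂ)) := rfl
    omega
  refine ⟨s.image fun y => selfAdjoint.expUnitary (lift y), ?_, fun U => ?_⟩
  · have hb : 1 ≤ 1 + 2 * Real.pi / ε := by
      have := Real.pi_pos
      have : 0 ≤ 2 * Real.pi / ε := by positivity
      linarith
    calc ((s.image fun y => selfAdjoint.expUnitary (lift y)).card : ℝ) ≤ s.card := by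
          exact_mod_cast Finset.card_image_le
      _ ≤ _ := hcard
      _ ≤ _ := pow_le_pow_right₀ hb hrank
  · obtain ⟨H, hH, hHU⟩ := exists_selfAdjoint_exp_eq U
    obtain ⟨y, hy, hdist⟩ := hs (T.mkQ H) ⟨H, hH, rfl⟩
    refine ⟨_, Finset.mem_image_of_mem _ hy, ?_⟩
    -- The quotient norm is an infimum over representatives: `m` is one of norm below ε, and its
    -- difference from `H - lift y` is a multiple c of the identity, which becomes the phase
    -- exp(ic).
    obtain ⟨m, hm, hmn⟩ := Submodule.Quotient.norm_mk_lt (S := T) (T.mkQ H - y)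
      (sub_pos.2 hdist)
    rw [add_sub_cancel] at hmn
    have hmem : H - lift y - m ∈ T := by
      rw [← Submodule.Quotient.mk_eq_zero, Submodule.Quotient.mk_sub, Submodule.Quotient.mk_sub,
        hm]
      have := hlift y
      simp only [Submodule.mkQ_apply] at this ⊢
      rw [this, sub_self]
    obtain ⟨c, hc⟩ := Submodule.mem_span_singleton.1 hmem
    refine ⟨Complex.exp (c * Complex.I), Complex.norm_exp_ofReal_mul_I c, ?_⟩
    have hK : m = H - (lift y + c • 1) := by rw [hc]; abel
    have h1 := norm_exp_sub_exp_le H (lift y + c • 1)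
    rw [← hK, hHU] at h1
    have h2 : NormedSpace.exp (Complex.I • ((lift y + c • 1 : S) : Matrix ι ι ℂ)) =
        Complex.exp (c * Complex.I) • (selfAdjoint.expUnitary (lift y) : Matrix ι ι ℂ) := by
      have h3 : Complex.I • ((lift y + c • 1 : S) : Matrix ι ι ℂ) =
          algebraMap ℂ (Matrix ι ι ℂ) (c * Complex.I) + Complex.I • (lift y : Matrix ι ι ℂ) := by
        rw [Algebra.algebraMap_eq_smul_one, mul_comm, mul_smul, add_comm, ← smul_add]
        rfl
      let _ : NormedAlgebra ℚ (Matrix ι ι ℂ) := NormedAlgebra.restrictScalars ℚ ℂ _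
      rw [h3, NormedSpace.exp_add_of_commute (Algebra.commutes _ _),
        ← NormedSpace.algebraMap_exp_comm, ← Complex.exp_eq_exp_ℂ, ← Algebra.smul_def]
      rfl
    rw [h2] at h1
    exact h1.trans hmn.le

end Nets

/-! ### Expectation values and their continuity in the state. -/

section Expectation

variable {ι : Type} [Fintype ι]

theorem isState_iff_norm {φ : ι → ℂ} : IsState φ ↔ ‖WithLp.toLp 2 φ‖ = 1 := by
  have h : star φ ⬝ᵥ φ = ((‖WithLp.toLp 2 φ‖ ^ 2 : ℝ) : ℂ) := by
    have := inner_self_eq_norm_sq_to_K (𝕜 := ℂ) (WithLp.toLp 2 φ)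
    rw [EuclideanSpace.inner_eq_star_dotProduct, dotProduct_comm] at this
    simpa using this
  rw [IsState, h]
  norm_cast
  exact pow_eq_one_iff_of_nonneg (norm_nonneg _) two_ne_zero

theorem expect_eq_inner (φ : ι → ℂ) (M : Matrix ι ι ℂ) :
    expect φ M = (inner ℂ (WithLp.toLp 2 φ) (WithLp.toLp 2 (M *ᵥ φ))).re := by
  rw [EuclideanSpace.inner_eq_star_dotProduct, dotProduct_comm]
  rfl

theorem expect_sum {κ : Type*} (φ : ι → ℂ) (s : Finset κ) (M : κ → Matrix ι ι ℂ) :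
    expect φ (∑ k ∈ s, M k) = ∑ k ∈ s, expect φ (M k) := by
  simp [expect, Matrix.sum_mulVec, dotProduct_sum]

theorem expect_sub (φ : ι → ℂ) (M N : Matrix ι ι ℂ) :
    expect φ (M - N) = expect φ M - expect φ N := by
  simp [expect, Matrix.sub_mulVec, dotProduct_sub]

theorem expect_one [DecidableEq ι] {φ : ι → ℂ} (hφ : IsState φ) : expect φ 1 = 1 := by
  rw [expect, Matrix.one_mulVec, hφ, Complex.one_re]

theorem expect_nonneg (φ : ι → ℂ) {M : Matrix ι ι ℂ} (hM : M.PosSemidef) : 0 ≤ expect φ M :=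
  (Complex.le_def.1 (hM.dotProduct_mulVec_nonneg φ)).1

theorem expect_smul_vec {z : ℂ} (hz : ‖z‖ = 1) (φ : ι → ℂ) (M : Matrix ι ι ℂ) :
    expect (z • φ) M = expect φ M := by
  have hzz : z * star z = 1 := by
    rw [Complex.star_def, Complex.mul_conj, Complex.normSq_eq_norm_sq, hz]; simp
  simp only [expect, star_smul, Matrix.mulVec_smul, smul_dotProduct, dotProduct_smul, smul_eq_mul,
    ← mul_assoc, hzz, one_mul]

theorem isState_smul {z : ℂ} (hz : ‖z‖ = 1) {φ : ι → ℂ} (hφ : IsState φ) : IsState (z • φ) := by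
  rw [isState_iff_norm] at *
  rw [WithLp.toLp_smul, norm_smul, hz, hφ, one_mul]

/-- M - M² = M(1 - M)M + (1 - M)M(1 - M). -/
theorem posSemidef_sub_sq [DecidableEq ι] {M : Matrix ι ι ℂ} (hM : M.PosSemidef)
    (hM1 : (1 - M).PosSemidef) : (M - M * M).PosSemidef := by
  have h1 := hM1.mul_mul_conjTranspose_same M
  have h2 := hM.mul_mul_conjTranspose_same (1 - M)
  rw [hM.isHermitian.eq] at h1
  rw [hM1.isHermitian.eq] at h2
  convert h1.add h2 using 1
  noncomm_ring

theorem expect_mul_self {M : Matrix ι ι ℂ} (hM : M.IsHermitian) (φ : ι → ℂ) :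
    expect φ (M * M) = ‖WithLp.toLp 2 (M *ᵥ φ)‖ ^ 2 := by
  have := inner_self_eq_norm_sq_to_K (𝕜 := ℂ) (WithLp.toLp 2 (M *ᵥ φ))
  rw [EuclideanSpace.inner_eq_star_dotProduct, dotProduct_comm] at this
  rw [expect, ← Matrix.mulVec_mulVec, Matrix.dotProduct_mulVec, ← hM.eq, ← Matrix.star_mulVec,
    hM.eq, this]
  norm_cast

/-- Quantitative continuity of a two-outcome measurement in the state. -/
theorem expect_sub_le [DecidableEq ι] {M : Matrix ι ι ℂ} (hM : M.PosSemidef)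
    (hM1 : (1 - M).PosSemidef) {φ ψ : ι → ℂ} (hφ : IsState φ) (hψ : IsState ψ) {d : ℝ}
    (hd : ‖WithLp.toLp 2 (φ - ψ)‖ ≤ d) :
    expect ψ M - expect φ M ≤
      2 * √(expect ψ M * (1 - expect ψ M)) * d + expect ψ M * d ^ 2 := by
  set p := expect ψ M with hp
  have hp0 : 0 ≤ p := expect_nonneg ψ hM
  have hd0 : 0 ≤ d := (norm_nonneg _).trans hd
  set x := WithLp.toLp 2 ψ with hx
  set y := WithLp.toLp 2 (φ - ψ) with hy
  set Mx := WithLp.toLp 2 (M *ᵥ ψ) with hMx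
  have hxn : ‖x‖ = 1 := isState_iff_norm.1 hψ
  have hxy : ‖x + y‖ = 1 := by
    have := isState_iff_norm.1 hφ
    rwa [hx, hy, ← WithLp.toLp_add, add_sub_cancel]
  -- Both vectors are unit, so the displacement along ψ is of second order.
  have hreal : (inner ℂ y x).re = -(‖y‖ ^ 2) / 2 := by
    have h1 := norm_add_sq (𝕜 := ℂ) x y
    rw [hxy, hxn, ← inner_conj_symm] at h1
    simp only [RCLike.re_to_complex, Complex.conj_re] at h1
    linarith
  have hpi : p = (inner ℂ x Mx).re := expect_eq_inner ψ M
  -- The part of Mψ orthogonal to ψ has squared norm ⟨M²⟩ - p² ≤ p - p², as M² ≤ M. This variance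
  -- factor makes the later bound proportional to η.
  have hsq : ‖Mx - (p : ℂ) • x‖ ≤ √(p * (1 - p)) := by
    apply Real.le_sqrt_of_sq_le
    have h1 := norm_sub_sq (𝕜 := ℂ) Mx ((p : ℂ) • x)
    rw [inner_smul_right, ← inner_conj_symm, norm_smul, hxn] at h1
    have h2 := expect_nonneg ψ (posSemidef_sub_sq hM hM1)
    rw [expect_sub, expect_mul_self hM.isHermitian, ← hMx, ← hp] at h2
    simp only [RCLike.re_to_complex, Complex.re_ofReal_mul, Complex.conj_re, ← hpi,
      Complex.norm_real, mul_one, Real.norm_eq_abs, sq_abs] at h1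
    rw [h1]
    linarith
  have hexp : expect φ M = p + 2 * (inner ℂ y Mx).re + expect (φ - ψ) M := by
    have h1 : star ψ ⬝ᵥ (M *ᵥ (φ - ψ)) = star (star (φ - ψ) ⬝ᵥ (M *ᵥ ψ)) := by
      rw [Matrix.star_dotProduct, Matrix.star_mulVec, hM.isHermitian.eq,
        Matrix.dotProduct_mulVec]
    have h2 : (inner ℂ y Mx).re = (star (φ - ψ) ⬝ᵥ (M *ᵥ ψ)).re := by
      rw [EuclideanSpace.inner_eq_star_dotProduct, dotProduct_comm]
    have h3 : star φ ⬝ᵥ (M *ᵥ φ) = star ψ ⬝ᵥ (M *ᵥ ψ) + star ψ ⬝ᵥ (M *ᵥ (φ - ψ)) +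
        star (φ - ψ) ⬝ᵥ (M *ᵥ ψ) + star (φ - ψ) ⬝ᵥ (M *ᵥ (φ - ψ)) := by
      simp only [star_sub, Matrix.mulVec_sub, dotProduct_sub, sub_dotProduct]
      ring
    rw [h2, hp, expect, expect, expect, h3, h1]
    simp only [Complex.add_re, Complex.star_def, Complex.conj_re]
    ring
  have hpos := expect_nonneg (φ - ψ) hM
  have hin : (inner ℂ y Mx).re = (inner ℂ y (Mx - (p : ℂ) • x)).re - p * (‖y‖ ^ 2 / 2) := by
    rw [inner_sub_right, inner_smul_right, Complex.sub_re, Complex.re_ofReal_mul, hreal]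
    ring
  have hcs : -(d * √(p * (1 - p))) ≤ (inner ℂ y (Mx - (p : ℂ) • x)).re := by
    have h1 := (Complex.abs_re_le_norm _).trans (norm_inner_le_norm (𝕜 := ℂ) y (Mx - (p : ℂ) • x))
    have h2 : ‖y‖ * ‖Mx - (p : ℂ) • x‖ ≤ d * √(p * (1 - p)) := by gcongr
    linarith [neg_abs_le (inner ℂ y (Mx - (p : ℂ) • x)).re]
  have hyd : p * ‖y‖ ^ 2 ≤ p * d ^ 2 := by gcongr
  rw [hexp, hin]
  linarith

end Expectation

/-! ### Local unitaries and the propagation of their errors. -/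

section Evolution

variable {α β : Type} [Fintype α] [DecidableEq α] [Fintype β] [DecidableEq β]

/-- An operator on Alice's register as an operator on the whole system. -/
def onAlice (α β : Type) [Fintype α] [DecidableEq α] [Fintype β] [DecidableEq β] :
    Matrix α α ℂ →⋆ₐ[ℂ] Matrix (Fin 2 × (α × β)) (Fin 2 × (α × β)) ℂ where
  toFun X := (1 : Matrix (Fin 2) (Fin 2) ℂ) ⊗ₖ (X ⊗ₖ (1 : Matrix β β ℂ))
  map_one' := by simp
  map_mul' X Y := by rw [← Matrix.mul_kronecker_mul, ← Matrix.mul_kronecker_mul, one_mul, one_mul]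
  map_zero' := by simp
  map_add' X Y := by simp [Matrix.add_kronecker, Matrix.kronecker_add]
  commutes' r := by
    simp [Algebra.algebraMap_eq_smul_one, Matrix.smul_kronecker, Matrix.kronecker_smul]
  map_star' X := by simp [Matrix.star_eq_conjTranspose, Matrix.conjTranspose_kronecker]

/-- An operator on Bob's register as an operator on the whole system. -/
def onBob (α β : Type) [Fintype α] [DecidableEq α] [Fintype β] [DecidableEq β] :
    Matrix β β ℂ →⋆ₐ[ℂ] Matrix (Fin 2 × (α × β)) (Fin 2 × (α × β)) ℂ where
  toFun X := (1 : Matrix (Fin 2) (Fin 2) ℂ) ⊗ₖ ((1 : Matrix α α ℂ) ⊗ₖ X)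
  map_one' := by simp
  map_mul' X Y := by rw [← Matrix.mul_kronecker_mul, ← Matrix.mul_kronecker_mul, one_mul, one_mul]
  map_zero' := by simp
  map_add' X Y := by simp [Matrix.kronecker_add]
  commutes' r := by
    simp [Algebra.algebraMap_eq_smul_one, Matrix.kronecker_smul]
  map_star' X := by simp [Matrix.star_eq_conjTranspose, Matrix.conjTranspose_kronecker]

theorem onAlice_mul_onBob (X : Matrix α α ℂ) (Y : Matrix β β ℂ) :
    onAlice α β X * onBob α β Y = (1 : Matrix (Fin 2) (Fin 2) ℂ) ⊗ₖ (X ⊗ₖ Y) := by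
  show (_ ⊗ₖ (_ ⊗ₖ _)) * (_ ⊗ₖ (_ ⊗ₖ _)) = _
  rw [← Matrix.mul_kronecker_mul, ← Matrix.mul_kronecker_mul, one_mul, one_mul, mul_one]

open scoped Matrix.Norms.L2Operator in
-- Star homomorphisms between C*-algebras are contractive, which bounds each one-sided operator by
-- its local norm.
theorem norm_local_mulVec_le (X : Matrix α α ℂ) (Y : Matrix β β ℂ)
    (ψ : Fin 2 × (α × β) → ℂ) :
    ‖WithLp.toLp 2 (((1 : Matrix (Fin 2) (Fin 2) ℂ) ⊗ₖ (X ⊗ₖ Y)) *ᵥ ψ)‖ ≤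
      ‖X‖ * ‖Y‖ * ‖WithLp.toLp 2 ψ‖ := by
  rw [← onAlice_mul_onBob]
  refine (Matrix.l2_opNorm_mulVec _ (WithLp.toLp 2 ψ)).trans ?_
  gcongr
  refine (norm_mul_le _ _).trans ?_
  gcongr
  · exact NonUnitalStarAlgHom.norm_apply_le (onAlice α β) X
  · exact NonUnitalStarAlgHom.norm_apply_le (onBob α β) Y

open scoped Matrix.Norms.L2Operator in
-- Telescoping: Alice's unitary, Bob's unitary and the state are replaced one at a time, all other
-- factors having norm at most 1, so the errors add.
theorem norm_local_sub_le (U U' : Matrix.unitaryGroup α ℂ) (V V' : Matrix.unitaryGroup β ℂ)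
    {z w : ℂ} (hz : ‖z‖ = 1) (hw : ‖w‖ = 1) {ε₁ ε₂ ε₃ : ℝ}
    (hU : ‖(U : Matrix α α ℂ) - z • (U' : Matrix α α ℂ)‖ ≤ ε₁)
    (hV : ‖(V : Matrix β β ℂ) - w • (V' : Matrix β β ℂ)‖ ≤ ε₂)
    {ψ ψ' : Fin 2 × (α × β) → ℂ} (hψ : IsState ψ) (hψ' : ‖WithLp.toLp 2 (ψ - ψ')‖ ≤ ε₃) :
    ‖WithLp.toLp 2 (((1 : Matrix (Fin 2) (Fin 2) ℂ) ⊗ₖ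
        ((U : Matrix α α ℂ) ⊗ₖ (V : Matrix β β ℂ))) *ᵥ ψ -
      (z * w) • (((1 : Matrix (Fin 2) (Fin 2) ℂ) ⊗ₖ
        ((U' : Matrix α α ℂ) ⊗ₖ (V' : Matrix β β ℂ))) *ᵥ ψ'))‖ ≤ ε₁ + ε₂ + ε₃ := by
  have hn : ∀ {κ : Type} [Fintype κ] [DecidableEq κ] (W : Matrix.unitaryGroup κ ℂ),
      ‖(W : Matrix κ κ ℂ)‖ ≤ 1 := by
    intro κ _ _ W
    rcases subsingleton_or_nontrivial (Matrix κ κ ℂ) with h | h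
    · rw [Subsingleton.elim (W : Matrix κ κ ℂ) 0, norm_zero]
      exact zero_le_one
    · exact (CStarRing.norm_of_mem_unitary W.2).le
  set U₁ : Matrix α α ℂ := z • (U' : Matrix α α ℂ) with hU₁
  set V₁ : Matrix β β ℂ := w • (V' : Matrix β β ℂ) with hV₁
  have hU1 : ‖U₁‖ ≤ 1 := by rw [hU₁, norm_smul, hz, one_mul]; exact hn U'
  have hV1 : ‖V₁‖ ≤ 1 := by rw [hV₁, norm_smul, hw, one_mul]; exact hn V'
  have hdec : ((1 : Matrix (Fin 2) (Fin 2) ℂ) ⊗ₖ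
        ((U : Matrix α α ℂ) ⊗ₖ (V : Matrix β β ℂ))) *ᵥ ψ -
      (z * w) • (((1 : Matrix (Fin 2) (Fin 2) ℂ) ⊗ₖ
        ((U' : Matrix α α ℂ) ⊗ₖ (V' : Matrix β β ℂ))) *ᵥ ψ') =
      ((1 : Matrix (Fin 2) (Fin 2) ℂ) ⊗ₖ (((U : Matrix α α ℂ) - U₁) ⊗ₖ (V : Matrix β β ℂ))) *ᵥ ψ +
      ((1 : Matrix (Fin 2) (Fin 2) ℂ) ⊗ₖ (U₁ ⊗ₖ ((V : Matrix β β ℂ) - V₁))) *ᵥ ψ +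
      ((1 : Matrix (Fin 2) (Fin 2) ℂ) ⊗ₖ (U₁ ⊗ₖ V₁)) *ᵥ (ψ - ψ') := by
    have h1 : (z * w) • (((1 : Matrix (Fin 2) (Fin 2) ℂ) ⊗ₖ
        ((U' : Matrix α α ℂ) ⊗ₖ (V' : Matrix β β ℂ))) *ᵥ ψ') =
        ((1 : Matrix (Fin 2) (Fin 2) ℂ) ⊗ₖ (U₁ ⊗ₖ V₁)) *ᵥ ψ' := by
      rw [hU₁, hV₁, Matrix.smul_kronecker, Matrix.kronecker_smul, Matrix.kronecker_smul,
        Matrix.kronecker_smul, smul_smul, Matrix.smul_mulVec]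
    have h2 : ((U : Matrix α α ℂ) ⊗ₖ (V : Matrix β β ℂ)) =
        (((U : Matrix α α ℂ) - U₁) ⊗ₖ (V : Matrix β β ℂ)) +
          (U₁ ⊗ₖ ((V : Matrix β β ℂ) - V₁)) + U₁ ⊗ₖ V₁ := by
      rw [add_assoc, ← Matrix.kronecker_add, sub_add_cancel, ← Matrix.add_kronecker,
        sub_add_cancel]
    rw [h1, h2, Matrix.kronecker_add, Matrix.kronecker_add, Matrix.add_mulVec, Matrix.add_mulVec,
      Matrix.mulVec_sub]
    abel
  have hψ1 : ‖WithLp.toLp 2 ψ‖ = 1 := isState_iff_norm.1 hψ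
  rw [hdec, WithLp.toLp_add, WithLp.toLp_add]
  refine (norm_add₃_le).trans ?_
  have hε₁ := (norm_nonneg _).trans hU
  have hε₂ := (norm_nonneg _).trans hV
  have hε₃ := (norm_nonneg _).trans hψ'
  gcongr
  · calc _ ≤ _ := norm_local_mulVec_le _ _ ψ
      _ ≤ ε₁ * 1 * 1 := by rw [hψ1]; gcongr; exact hn V
      _ = ε₁ := by ring
  · calc _ ≤ _ := norm_local_mulVec_le _ _ ψ
      _ ≤ 1 * ε₂ * 1 := by rw [hψ1]; gcongr
      _ = ε₂ := by ring
  · calc _ ≤ _ := norm_local_mulVec_le _ _ (ψ - ψ')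
      _ ≤ 1 * 1 * ε₃ := by gcongr
      _ = ε₃ := by ring

theorem isState_local (U : Matrix.unitaryGroup α ℂ) (V : Matrix.unitaryGroup β ℂ)
    {ψ : Fin 2 × (α × β) → ℂ} (hψ : IsState ψ) :
    IsState (((1 : Matrix (Fin 2) (Fin 2) ℂ) ⊗ₖ
      ((U : Matrix α α ℂ) ⊗ₖ (V : Matrix β β ℂ))) *ᵥ ψ) := by
  have hU : (U : Matrix α α ℂ)ᴴ * U = 1 := Matrix.mem_unitaryGroup_iff'.1 U.2
  have hV : (V : Matrix β β ℂ)ᴴ * V = 1 := Matrix.mem_unitaryGroup_iff'.1 V.2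
  rw [IsState, Matrix.star_mulVec, ← Matrix.dotProduct_mulVec, Matrix.mulVec_mulVec,
    Matrix.conjTranspose_kronecker, Matrix.conjTranspose_kronecker, ← Matrix.mul_kronecker_mul,
    ← Matrix.mul_kronecker_mul, hU, hV]
  simpa [IsState] using hψ

end Evolution

/-! ### The exchange of qubits as a relabelling of the computational basis. -/

section Exchange

variable {q : ℕ}

/-- The regrouping of the registers in the exchange. -/
def exchangeEquiv (KA KB : Finset (Fin q)) :
    Fin 2 × ((BitsIn KA × BitsOut KB) × (BitsOut KA × BitsIn KB)) ≃
      Fin 2 × (Bits q × Bits q) where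
  toFun z := (z.1, (glue KA z.2.1.1 z.2.2.1, glue KB z.2.2.2 z.2.1.2))
  invFun w :=
    let s := Equiv.piEquivPiSubtypeProd (fun i => i ∈ KA) (fun _ => Bool) w.2.1
    let t := Equiv.piEquivPiSubtypeProd (fun i => i ∈ KB) (fun _ => Bool) w.2.2
    (w.1, ((s.1, t.2), (s.2, t.1)))
  left_inv z := by simp only [glue, Equiv.apply_symm_apply]
  right_inv w := by simp only [glue, Prod.mk.eta, Equiv.symm_apply_apply]

/-- The state after the qubits outside `KA` and `KB` have been exchanged. -/
def exchange (KA KB : Finset (Fin q)) (φ : Fin 2 × (Bits q × Bits q) → ℂ) :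
    Fin 2 × ((BitsIn KA × BitsOut KB) × (BitsOut KA × BitsIn KB)) → ℂ :=
  φ ∘ exchangeEquiv KA KB

theorem norm_exchange (KA KB : Finset (Fin q)) (φ : Fin 2 × (Bits q × Bits q) → ℂ) :
    ‖WithLp.toLp 2 (exchange KA KB φ)‖ = ‖WithLp.toLp 2 φ‖ := by
  rw [EuclideanSpace.norm_eq, EuclideanSpace.norm_eq]
  congr 1
  exact Equiv.sum_comp (exchangeEquiv KA KB) fun i => ‖φ i‖ ^ 2

theorem isState_exchange (KA KB : Finset (Fin q)) {φ : Fin 2 × (Bits q × Bits q) → ℂ}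
    (hφ : IsState φ) : IsState (exchange KA KB φ) := by
  rw [isState_iff_norm] at *
  rw [norm_exchange, hφ]

end Exchange

/-! ### The joint measurement of verifiers and attackers, and its events. -/

section Outcomes

theorem star_phase_mul_phase (t : ℝ) :
    (starRingEnd ℂ) (Complex.exp (Complex.I * t)) * Complex.exp (Complex.I * t) = 1 := by
  rw [mul_comm, Complex.mul_conj, Complex.normSq_eq_norm_sq, mul_comm, Complex.norm_exp_ofReal_mul_I]
  simp

variable {mθ mφ : ℕ}

theorem isState_basisVec (i : Fin (numBases mθ mφ)) (a : Fin 2) :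
    IsState (basisVec mθ mφ i a) := by
  have h1 := star_phase_mul_phase (azimuth mθ mφ i)
  have h2 : ((Real.sin (theta mθ mφ i / 2) : ℝ) : ℂ) ^ 2 +
      ((Real.cos (theta mθ mφ i / 2) : ℝ) : ℂ) ^ 2 = 1 := by
    exact_mod_cast Real.sin_sq_add_cos_sq (theta mθ mφ i / 2)
  simp only [IsState, dotProduct, Fin.sum_univ_two, basisVec, Pi.star_apply, Complex.star_def]
  split_ifs <;> simp only [Matrix.cons_val_zero, Matrix.cons_val_one, map_mul, map_neg,
    Complex.conj_ofReal]
  · linear_combination (((Real.sin (theta mθ mφ i / 2) : ℝ) : ℂ) ^ 2) * h1 + h2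
  · linear_combination (((Real.cos (theta mθ mφ i / 2) : ℝ) : ℂ) ^ 2) * h1 + h2

theorem verifierProj_posSemidef (i : Fin (numBases mθ mφ)) (a : Fin 2) :
    (verifierProj mθ mφ i a).PosSemidef :=
  Matrix.posSemidef_vecMulVec_self_star _

theorem sum_verifierProj (i : Fin (numBases mθ mφ)) : ∑ a, verifierProj mθ mφ i a = 1 := by
  have h1 := star_phase_mul_phase (azimuth mθ mφ i)
  have h2 : ((Real.sin (theta mθ mφ i / 2) : ℝ) : ℂ) ^ 2 +
      ((Real.cos (theta mθ mφ i / 2) : ℝ) : ℂ) ^ 2 = 1 := by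
    exact_mod_cast Real.sin_sq_add_cos_sq (theta mθ mφ i / 2)
  ext k l
  simp only [Fin.sum_univ_two, verifierProj, basisVec, Matrix.add_apply, Matrix.vecMulVec_apply,
    Pi.star_apply, Complex.star_def, if_true, one_ne_zero, if_false]
  fin_cases k <;> fin_cases l <;> simp only [Fin.zero_eta, Fin.mk_one, Matrix.cons_val_zero,
    Matrix.cons_val_one, map_mul, map_neg, Complex.conj_ofReal, Matrix.one_apply_eq, ne_eq,
    Matrix.one_apply_ne, one_ne_zero, zero_ne_one, not_false_eq_true]
  · linear_combination h2
  · ring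
  · ring
  · linear_combination h1 * (((Real.sin (theta mθ mφ i / 2) : ℝ) : ℂ) ^ 2 +
      ((Real.cos (theta mθ mφ i / 2) : ℝ) : ℂ) ^ 2) + h2

variable {α β : Type} [Fintype α] [DecidableEq α] [Fintype β] [DecidableEq β]

/-- The POVM element of the verifiers' outcome `k.1` and the answers `k.2`. -/
noncomputable def jointOp (i : Fin (numBases mθ mφ)) (A : POVM α) (B : POVM β) (k : Fin 2 × Answer × Answer) :
    Matrix (Fin 2 × (α × β)) (Fin 2 × (α × β)) ℂ :=
  verifierProj mθ mφ i k.1 ⊗ₖ (A.op k.2.1 ⊗ₖ B.op k.2.2)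

theorem jointOp_posSemidef (i : Fin (numBases mθ mφ)) (A : POVM α) (B : POVM β)
    (k : Fin 2 × Answer × Answer) : (jointOp i A B k).PosSemidef :=
  (verifierProj_posSemidef i k.1).kronecker ((A.posSemidef k.2.1).kronecker (B.posSemidef k.2.2))

theorem sum_kronecker {κ l m n p : Type*} (s : Finset κ) (f : κ → Matrix l m ℂ)
    (g : Matrix n p ℂ) : (∑ k ∈ s, f k) ⊗ₖ g = ∑ k ∈ s, f k ⊗ₖ g := by
  ext
  simp [Matrix.sum_apply, Finset.sum_mul]

theorem kronecker_sum {κ l m n p : Type*} (s : Finset κ) (f : Matrix l m ℂ)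
    (g : κ → Matrix n p ℂ) : f ⊗ₖ (∑ k ∈ s, g k) = ∑ k ∈ s, f ⊗ₖ g k := by
  ext
  simp [Matrix.sum_apply, Finset.mul_sum]

theorem sum_jointOp (i : Fin (numBases mθ mφ)) (A : POVM α) (B : POVM β) :
    ∑ k, jointOp i A B k = 1 := by
  have h : (∑ v, verifierProj mθ mφ i v) ⊗ₖ ((∑ a, A.op a) ⊗ₖ (∑ b, B.op b)) =
      (1 : Matrix (Fin 2 × (α × β)) (Fin 2 × (α × β)) ℂ) := by
    rw [sum_verifierProj, A.sum_eq_one, B.sum_eq_one, Matrix.one_kronecker_one,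
      Matrix.one_kronecker_one]
  rw [← h]
  simp only [sum_kronecker, kronecker_sum, Fintype.sum_prod_type, jointOp]
  refine (Finset.sum_congr rfl fun _ _ => Finset.sum_comm).trans ?_
  rw [Finset.sum_comm]
  exact Finset.sum_congr rfl fun _ _ => Finset.sum_comm

/-- The probability of an event for the verifiers' outcome and the two answers. -/
noncomputable def eventProb (i : Fin (numBases mθ mφ)) (φ : Fin 2 × (α × β) → ℂ) (A : POVM α) (B : POVM β)
    (s : Finset (Fin 2 × Answer × Answer)) : ℝ :=
  expect φ (∑ k ∈ s, jointOp i A B k)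

theorem eventProb_eq_sum (i : Fin (numBases mθ mφ)) (φ : Fin 2 × (α × β) → ℂ) (A : POVM α)
    (B : POVM β) (s : Finset (Fin 2 × Answer × Answer)) :
    eventProb i φ A B s = ∑ k ∈ s, expect φ (jointOp i A B k) :=
  expect_sum _ _ _

theorem eventProb_nonneg (i : Fin (numBases mθ mφ)) (φ : Fin 2 × (α × β) → ℂ) (A : POVM α)
    (B : POVM β) (s : Finset (Fin 2 × Answer × Answer)) : 0 ≤ eventProb i φ A B s := by
  rw [eventProb_eq_sum]
  exact Finset.sum_nonneg fun k _ => expect_nonneg φ (jointOp_posSemidef i A B k)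

theorem eventProb_univ (i : Fin (numBases mθ mφ)) {φ : Fin 2 × (α × β) → ℂ} (hφ : IsState φ)
    (A : POVM α) (B : POVM β) : eventProb i φ A B Finset.univ = 1 := by
  rw [eventProb, sum_jointOp, expect_one hφ]

theorem eventProb_le_one (i : Fin (numBases mθ mφ)) {φ : Fin 2 × (α × β) → ℂ} (hφ : IsState φ)
    (A : POVM α) (B : POVM β) (s : Finset (Fin 2 × Answer × Answer)) :
    eventProb i φ A B s ≤ 1 := by
  rw [← eventProb_univ i hφ A B, eventProb_eq_sum, eventProb_eq_sum]
  exact Finset.sum_le_sum_of_subset_of_nonneg (Finset.subset_univ s)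
    fun k _ _ => expect_nonneg φ (jointOp_posSemidef i A B k)

/-- An event and its complement are both sums of POVM elements, so one continuity estimate serves
every record of the verifiers. -/
theorem eventProb_sub_le (i : Fin (numBases mθ mφ)) (A : POVM α) (B : POVM β)
    (s : Finset (Fin 2 × Answer × Answer)) {φ ψ : Fin 2 × (α × β) → ℂ} (hφ : IsState φ)
    (hψ : IsState ψ) {d : ℝ} (hd : ‖WithLp.toLp 2 (φ - ψ)‖ ≤ d) :
    eventProb i ψ A B s - eventProb i φ A B s ≤
      2 * √(eventProb i ψ A B s * (1 - eventProb i ψ A B s)) * d +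
        eventProb i ψ A B s * d ^ 2 := by
  refine expect_sub_le ?_ ?_ hφ hψ hd
  · exact Matrix.posSemidef_sum _ fun k _ => jointOp_posSemidef i A B k
  · rw [← sum_jointOp i A B, ← Finset.sum_sdiff (Finset.subset_univ s), add_sub_cancel_right]
    exact Matrix.posSemidef_sum _ fun k _ => jointOp_posSemidef i A B k

theorem abs_eventProb_sub_le (i : Fin (numBases mθ mφ)) (A : POVM α) (B : POVM β)
    (s : Finset (Fin 2 × Answer × Answer)) {φ ψ : Fin 2 × (α × β) → ℂ} (hφ : IsState φ)
    (hψ : IsState ψ) {d : ℝ} (hd : ‖WithLp.toLp 2 (φ - ψ)‖ ≤ d) :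
    |eventProb i ψ A B s - eventProb i φ A B s| ≤ d + d ^ 2 := by
  have key : ∀ {φ ψ : Fin 2 × (α × β) → ℂ}, IsState φ → IsState ψ →
      ‖WithLp.toLp 2 (φ - ψ)‖ ≤ d →
      eventProb i ψ A B s - eventProb i φ A B s ≤ d + d ^ 2 := by
    intro φ ψ hφ hψ hd
    have hd0 : 0 ≤ d := (norm_nonneg _).trans hd
    have h1 := eventProb_sub_le i A B s hφ hψ hd
    set p := eventProb i ψ A B s
    have hp1 : p ≤ 1 := eventProb_le_one i hψ A B s
    have h2 : √(p * (1 - p)) ≤ 1 / 2 := by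
      rw [Real.sqrt_le_left (by norm_num)]
      nlinarith [sq_nonneg (p - 1 / 2)]
    have h3 : 2 * √(p * (1 - p)) * d ≤ 2 * (1 / 2) * d := by gcongr
    have h4 : p * d ^ 2 ≤ 1 * d ^ 2 := by gcongr
    linarith
  rw [abs_le]
  have h1 := key hφ hψ hd
  have h2 := key hψ hφ (by
    rw [← neg_sub, WithLp.toLp_neg, norm_neg]
    exact hd)
  constructor <;> linarith

theorem correctProb_eq (i : Fin (numBases mθ mφ)) (φ : Fin 2 × (α × β) → ℂ) (A : POVM α)
    (B : POVM β) : correctProb mθ mφ i φ A B =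
      eventProb i φ A B {k | k.2.1 = some k.1 ∧ k.2.2 = some k.1} := by
  rw [eventProb_eq_sum, Finset.sum_filter]
  simp [Fintype.sum_prod_type, Fintype.sum_option, Fin.sum_univ_two, correctProb, jointOp]

theorem wrongProb_eq (i : Fin (numBases mθ mφ)) (φ : Fin 2 × (α × β) → ℂ) (A : POVM α)
    (B : POVM β) : wrongProb mθ mφ i φ A B =
      eventProb i φ A B {k | k.2.1 = some (1 - k.1) ∧ k.2.2 = some (1 - k.1)} := by
  rw [eventProb_eq_sum, Finset.sum_filter]
  simp [Fintype.sum_prod_type, Fintype.sum_option, Fin.sum_univ_two, wrongProb, jointOp]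

/-- The basis `i` is arbitrary: summing over the verifiers' outcome removes it. -/
theorem answerProb_eq (i : Fin (numBases mθ mφ)) (φ : Fin 2 × (α × β) → ℂ) (A : POVM α)
    (B : POVM β) (a b : Answer) :
    answerProb φ A B a b = eventProb i φ A B {k | k.2 = (a, b)} := by
  have h : (1 : Matrix (Fin 2) (Fin 2) ℂ) ⊗ₖ (A.op a ⊗ₖ B.op b) =
      ∑ v, jointOp i A B (v, (a, b)) := by
    rw [← sum_verifierProj i, sum_kronecker]
    rfl
  rw [answerProb, h, expect_sum, eventProb_eq_sum, Finset.sum_filter, Fintype.sum_prod_type]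
  simp

theorem abortProb_eq (i : Fin (numBases mθ mφ)) (φ : Fin 2 × (α × β) → ℂ) (A : POVM α)
    (B : POVM β) : abortProb φ A B = eventProb i φ A B {k | k.2.1 ≠ k.2.2} := by
  simp only [abortProb, answerProb_eq i, eventProb_eq_sum, Finset.sum_filter,
    Fintype.sum_prod_type]
  simp [Fintype.sum_option, Fin.sum_univ_two]
  ring

theorem answerProb_nonneg (i : Fin (numBases mθ mφ)) (φ : Fin 2 × (α × β) → ℂ) (A : POVM α)
    (B : POVM β) (a b : Answer) : 0 ≤ answerProb φ A B a b := by
  rw [answerProb_eq i]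
  exact eventProb_nonneg _ _ _ _ _

theorem sum_outcomes (i : Fin (numBases mθ mφ)) {φ : Fin 2 × (α × β) → ℂ} (hφ : IsState φ)
    (A : POVM α) (B : POVM β) :
    correctProb mθ mφ i φ A B + wrongProb mθ mφ i φ A B + abortProb φ A B +
      noPhotonProb φ A B = 1 := by
  rw [← eventProb_univ i hφ A B, correctProb_eq, wrongProb_eq, abortProb_eq i, noPhotonProb,
    answerProb_eq i]
  simp only [eventProb_eq_sum, Finset.sum_filter, Fintype.sum_prod_type]
  simp [Fintype.sum_option, Fin.sum_univ_two]
  ring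

end Outcomes

/-! ### Bounds relating attacks, `pTilde` and `wTilde`. -/

section Values

variable {mθ mφ : ℕ}
variable {α β : Type} [Fintype α] [DecidableEq α] [Fintype β] [DecidableEq β]

theorem correctProb_nonneg (i : Fin (numBases mθ mφ)) (φ : Fin 2 × (α × β) → ℂ) (A : POVM α)
    (B : POVM β) : 0 ≤ correctProb mθ mφ i φ A B := by
  rw [correctProb_eq]
  exact eventProb_nonneg _ _ _ _ _

theorem wrongProb_nonneg (i : Fin (numBases mθ mφ)) (φ : Fin 2 × (α × β) → ℂ) (A : POVM α)
    (B : POVM β) : 0 ≤ wrongProb mθ mφ i φ A B := by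
  rw [wrongProb_eq]
  exact eventProb_nonneg _ _ _ _ _

theorem correctProb_le_one (i : Fin (numBases mθ mφ)) {φ : Fin 2 × (α × β) → ℂ} (hφ : IsState φ)
    (A : POVM α) (B : POVM β) : correctProb mθ mφ i φ A B ≤ 1 := by
  rw [correctProb_eq]
  exact eventProb_le_one _ hφ _ _ _

theorem correctProb_le_mul_pTilde {η ξ : ℝ} (hη : 0 < η) (i : Fin (numBases mθ mφ))
    {φ : Fin 2 × (α × β) → ℂ} (hφ : IsState φ) {A : POVM α} {B : POVM β}
    (h : Admissible η ξ φ A B) :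
    correctProb mθ mφ i φ A B ≤ η * pTilde mθ mφ η ξ i φ := by
  rw [pTilde, ← mul_assoc, mul_one_div_cancel hη.ne', one_mul]
  refine le_csSup ⟨1, ?_⟩ ⟨A, B, h, rfl⟩
  rintro _ ⟨A, B, -, rfl⟩
  exact correctProb_le_one i hφ A B

theorem pTilde_le {η : ℝ} (hη : 0 < η) (ξ : ℝ) (i : Fin (numBases mθ mφ))
    {φ : Fin 2 × (α × β) → ℂ} (hφ : IsState φ) : pTilde mθ mφ η ξ i φ ≤ 1 / η := by
  rw [pTilde]
  -- `zero_le_one` also covers the case without admissible POVMs, where the supremum is 0.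
  refine mul_le_of_le_one_right (by positivity) (Real.sSup_le ?_ zero_le_one)
  rintro _ ⟨A, B, -, rfl⟩
  exact correctProb_le_one i hφ A B

theorem numBases_pos (mθ mφ : ℕ) : 0 < numBases mθ mφ := Nat.succ_pos _

theorem average_pTilde_le_wTilde {η : ℝ} (hη : 0 < η) (ξ : ℝ) {φ : Fin 2 × (α × β) → ℂ}
    (hφ : IsState φ) :
    1 / (numBases mθ mφ : ℝ) * ∑ i, pTilde mθ mφ η ξ i φ ≤ wTilde mθ mφ ξ η := by
  have hm : (0 : ℝ) < numBases mθ mφ := by exact_mod_cast numBases_pos mθ mφ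
  refine le_csSup ⟨1 / η, ?_⟩ ⟨α, β, _, _, _, _, φ, hφ, rfl⟩
  rintro _ ⟨α, β, _, _, _, _, φ, hφ, rfl⟩
  rw [one_div_mul_eq_div, div_le_iff₀ hm]
  calc ∑ i, pTilde mθ mφ η ξ i φ ≤ ∑ _i : Fin (numBases mθ mφ), 1 / η :=
        Finset.sum_le_sum fun i _ => pTilde_le hη ξ i hφ
    _ = 1 / η * numBases mθ mφ := by simp [mul_comm]

theorem exists_pTilde_le_wTilde {η : ℝ} (hη : 0 < η) (ξ : ℝ) {φ : Fin 2 × (α × β) → ℂ}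
    (hφ : IsState φ) : ∃ i, pTilde mθ mφ η ξ i φ ≤ wTilde mθ mφ ξ η := by
  have hm : (0 : ℝ) < numBases mθ mφ := by exact_mod_cast numBases_pos mθ mφ
  have h := average_pTilde_le_wTilde (mθ := mθ) (mφ := mφ) hη ξ hφ
  by_contra! hlt
  have : ∑ _i : Fin (numBases mθ mφ), wTilde mθ mφ ξ η < ∑ i, pTilde mθ mφ η ξ i φ :=
    Finset.sum_lt_sum_of_nonempty ⟨⟨0, numBases_pos mθ mφ⟩, Finset.mem_univ _⟩ fun i _ => hlt i
  rw [one_div_mul_eq_div, div_le_iff₀ hm] at h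
  simp only [Finset.sum_const, Finset.card_univ, Fintype.card_fin, nsmul_eq_mul] at this
  linarith

/-- The point is √(c(1 - c)) ≤ 2η. For η ≥ 1/4 use c(1 - c) ≤ 1/4; below that, c(1 - c) ≤ η(1 - η) ≤
4η², whose last inequality is exactly η ≥ 1/5. Then 4 · 0.002247 + 0.002247² < 0.009. -/
theorem sqrt_perturbation_le {c η d : ℝ} (hc : 0 ≤ c) (hcη : c ≤ η) (hη : 1 / 5 ≤ η)
    (hd0 : 0 ≤ d) (hd : d ≤ 0.002247) : 2 * √(c * (1 - c)) * d + c * d ^ 2 ≤ η * 0.009 := by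
  have h1 : √(c * (1 - c)) ≤ 2 * η := by
    rw [Real.sqrt_le_left (by linarith)]
    rcases le_total (1 / 4) η with h | h
    · nlinarith [sq_nonneg (c - 1 / 2)]
    · nlinarith [mul_nonneg hc (sub_nonneg.2 hcη)]
  have h2 : 2 * √(c * (1 - c)) * d ≤ 2 * (2 * η) * 0.002247 := by gcongr
  have h3 : c * d ^ 2 ≤ η * 0.002247 ^ 2 := by gcongr
  linarith

/-- If an attack on `ψ` never gives different answers and responds with probability `η`, it is
correct with probability at most `η (p̃_φ + Δ)` for every state `φ` near `ψ`. -/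
theorem correctProb_le_of_near {η : ℝ} (hη : 1 / 5 ≤ η) (i : Fin (numBases mθ mφ))
    {φ ψ : Fin 2 × (α × β) → ℂ} (hφ : IsState φ) (hψ : IsState ψ)
    (hd : ‖WithLp.toLp 2 (φ - ψ)‖ ≤ 0.002247) {A : POVM α} {B : POVM β}
    (hno : noPhotonProb ψ A B = 1 - η) (hab : abortProb ψ A B = 0) :
    correctProb mθ mφ i ψ A B ≤ η * (pTilde mθ mφ η 0.005 i φ + 0.009) := by
  have hη0 : 0 < η := by linarith
  -- Each answer probability moves by at most d + d² < 0.005 = ξ, while on ψ differing answers have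
  -- probability 0 and ⊥, ⊥ exactly 1 - η.
  have hadm : Admissible η 0.005 φ A B := by
    have habs : ∀ a b, |answerProb ψ A B a b - answerProb φ A B a b| ≤ 0.005 := by
      intro a b
      rw [answerProb_eq i, answerProb_eq i]
      refine (abs_eventProb_sub_le i A B _ hφ hψ hd).trans ?_
      norm_num
    refine ⟨fun a b hne => ?_, ?_, ?_⟩
    · have h0 : answerProb ψ A B a b ≤ abortProb ψ A B := by
        have h1 : ∀ a b : Answer, 0 ≤ if a ≠ b then answerProb ψ A B a b else 0 := by
          intro a b
          split_ifs
          exacts [answerProb_nonneg i _ _ _ _ _, le_rfl]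
        have h2 := Finset.single_le_sum (f := fun b => if a ≠ b then answerProb ψ A B a b else 0)
          (fun b _ => h1 a b) (Finset.mem_univ b)
        have h3 := Finset.single_le_sum
          (f := fun a => ∑ b, if a ≠ b then answerProb ψ A B a b else 0)
          (fun a _ => Finset.sum_nonneg fun b _ => h1 a b) (Finset.mem_univ a)
        simp only [if_pos hne] at h2
        exact h2.trans h3
      linarith [(abs_le.1 (habs a b)).1]
    · linarith [(abs_le.1 (habs none none)).2, show noPhotonProb ψ A B = answerProb ψ A B none none
        from rfl, show noPhotonProb φ A B = answerProb φ A B none none from rfl]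
    · linarith [(abs_le.1 (habs none none)).1, show noPhotonProb ψ A B = answerProb ψ A B none none
        from rfl, show noPhotonProb φ A B = answerProb φ A B none none from rfl]
  have h1 := correctProb_le_mul_pTilde hη0 i hφ hadm
  have h2 := sum_outcomes i hψ A B
  have h3 := wrongProb_nonneg i ψ A B
  have h4 := correctProb_nonneg i ψ A B
  have h5 := eventProb_sub_le i A B {k | k.2.1 = some k.1 ∧ k.2.2 = some k.1} hφ hψ hd
  rw [← correctProb_eq, ← correctProb_eq] at h5
  have h6 := sqrt_perturbation_le h4 (by linarith : correctProb mθ mφ i ψ A B ≤ η) hη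
    (by norm_num) le_rfl
  linarith

end Values

/-! ### The attack that guesses the basis. -/

section Guessing

variable {κ : Type} [Fintype κ] [DecidableEq κ]

/-- The measurement that reads a classical register and answers `g`. -/
noncomputable def readPOVM (g : κ → Answer) : POVM κ where
  op a := Matrix.diagonal fun x => if g x = a then 1 else 0
  posSemidef a := by
    refine Matrix.PosSemidef.diagonal fun x => ?_
    show (0 : ℂ) ≤ if g x = a then 1 else 0
    split_ifs
    exacts [zero_le_one, le_rfl]
  sum_eq_one := by
    ext x y
    rw [Matrix.sum_apply]
    by_cases h : x = y
    · subst h; simp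
    · simp [h]

/-- The state in which both attackers hold `x` when the verifiers hold `χ x`. -/
noncomputable def sharedState (χ : κ → Fin 2 → ℂ) : Fin 2 × (κ × κ) → ℂ :=
  fun z => if z.2.1 = z.2.2 then χ z.2.1 z.1 else 0

theorem isState_sharedState {χ : κ → Fin 2 → ℂ} (h : ∑ x, star (χ x) ⬝ᵥ χ x = 1) :
    IsState (sharedState χ) := by
  rw [IsState, ← h]
  simp only [dotProduct, Fintype.sum_prod_type, sharedState, Pi.star_apply]
  rw [Finset.sum_comm]
  refine Finset.sum_congr rfl fun x _ => ?_
  refine Finset.sum_congr rfl fun v _ => ?_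
  rw [Finset.sum_eq_single x] <;> simp +contextual [eq_comm]

theorem expect_sharedState (χ : κ → Fin 2 → ℂ) (g : κ → Answer) (N : Matrix (Fin 2) (Fin 2) ℂ)
    (a b : Answer) :
    expect (sharedState χ) (N ⊗ₖ ((readPOVM g).op a ⊗ₖ (readPOVM g).op b)) =
      ∑ x, if g x = a ∧ g x = b then expect (χ x) N else 0 := by
  have h : star (sharedState χ) ⬝ᵥ
      ((N ⊗ₖ ((readPOVM g).op a ⊗ₖ (readPOVM g).op b)) *ᵥ sharedState χ) =
      ∑ x, if g x = a ∧ g x = b then star (χ x) ⬝ᵥ (N *ᵥ χ x) else 0 := by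
    have h1 : ∀ v x y, ((N ⊗ₖ ((readPOVM g).op a ⊗ₖ (readPOVM g).op b)) *ᵥ sharedState χ)
        (v, (x, y)) = if x = y ∧ g x = a ∧ g y = b then (N *ᵥ χ x) v else 0 := by
      intro v x y
      simp only [Matrix.mulVec, dotProduct, Fintype.sum_prod_type, Matrix.kroneckerMap_apply,
        readPOVM, Matrix.diagonal_apply, sharedState]
      rw [Finset.sum_congr rfl fun w _ => by
        rw [Finset.sum_eq_single x (by simp +contextual [eq_comm]) (by simp),
          Finset.sum_eq_single y (by simp +contextual [eq_comm]) (by simp)]]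
      by_cases hxy : x = y <;> by_cases ha : g x = a <;> by_cases hb : g y = b <;>
        simp [hxy, ha, hb]
    simp only [dotProduct, Fintype.sum_prod_type, h1, Pi.star_apply, sharedState]
    rw [Finset.sum_comm]
    refine Finset.sum_congr rfl fun x _ => ?_
    rw [Finset.sum_congr rfl fun w _ => by
        rw [Finset.sum_eq_single x (by simp +contextual [eq_comm]) (by simp)]]
    by_cases hab : g x = a ∧ g x = b <;> simp [hab]
  rw [expect, h, Complex.re_sum]
  refine Finset.sum_congr rfl fun x _ => ?_
  split_ifs <;> simp [expect]

variable {mθ mφ : ℕ}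

/-- Guessing the basis in advance and answering only if the guess is right. -/
theorem one_le_wTilde {η ξ : ℝ} (hη : 0 < η) (hξ : 0 ≤ ξ) (hm : (numBases mθ mφ : ℝ) * η ≤ 1) :
    1 ≤ wTilde mθ mφ ξ η := by
  let m := numBases mθ mφ
  -- Each pair (basis, bit) carries weight η/2, so answering only on the right guess responds with
  -- probability η and is always correct. The remaining weight 1 - mη sits on a flag that is always
  -- answered by ⊥.
  let χ : Option (Fin m × Fin 2) → Fin 2 → ℂ := fun x => x.elim
    ((√(1 - m * η) : ℂ) • Pi.single 0 1) fun js => (√(η / 2) : ℂ) • basisVec mθ mφ js.1 js.2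
  let g : Fin m → Option (Fin m × Fin 2) → Answer := fun i x => x.elim none
    fun js => if js.1 = i then some js.2 else none
  have hsm : ∀ (r : ℝ) (v : Fin 2 → ℂ) (N : Matrix (Fin 2) (Fin 2) ℂ), 0 ≤ r →
      star ((√r : ℂ) • v) ⬝ᵥ (N *ᵥ ((√r : ℂ) • v)) = r * (star v ⬝ᵥ (N *ᵥ v)) := by
    intro r v N hr
    have : ((√r : ℝ) : ℂ) * ((√r : ℝ) : ℂ) = r := by exact_mod_cast Real.mul_self_sqrt hr
    simp only [star_smul, Matrix.mulVec_smul, smul_dotProduct, dotProduct_smul, smul_eq_mul,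
      Complex.star_def, Complex.conj_ofReal, ← mul_assoc, this]
  have hnone : ∀ N, star (χ none) ⬝ᵥ (N *ᵥ χ none) =
      ((1 - m * η : ℝ) : ℂ) * (star (Pi.single 0 1) ⬝ᵥ (N *ᵥ Pi.single 0 1)) :=
    fun N => hsm _ _ N (by linarith)
  have hsome : ∀ js N, star (χ (some js)) ⬝ᵥ (N *ᵥ χ (some js)) =
      ((η / 2 : ℝ) : ℂ) * (star (basisVec mθ mφ js.1 js.2) ⬝ᵥ (N *ᵥ basisVec mθ mφ js.1 js.2)) :=
    fun js N => hsm _ _ N (by linarith)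
  have hnone1 : expect (χ none) 1 = 1 - m * η := by
    rw [expect, hnone]
    simp
  have hsome1 : ∀ js, expect (χ (some js)) 1 = η / 2 := by
    intro js
    have h := isState_basisVec (mθ := mθ) (mφ := mφ) js.1 js.2
    rw [IsState] at h
    rw [expect, hsome, Matrix.one_mulVec, h, mul_one, Complex.ofReal_re]
  have hsomeV : ∀ js, expect (χ (some js)) (verifierProj mθ mφ js.1 js.2) = η / 2 := by
    intro js
    have h := isState_basisVec (mθ := mθ) (mφ := mφ) js.1 js.2
    rw [IsState] at h
    rw [expect, hsome, verifierProj, Matrix.vecMulVec_mulVec, h]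
    simp [h]
  have hstate : IsState (sharedState χ) := by
    apply isState_sharedState
    have h1 : ∀ x, star (χ x) ⬝ᵥ χ x = star (χ x) ⬝ᵥ ((1 : Matrix (Fin 2) (Fin 2) ℂ) *ᵥ χ x) :=
      fun x => by rw [Matrix.one_mulVec]
    rw [Fintype.sum_option]
    simp only [h1, hnone, hsome]
    simp only [Matrix.one_mulVec, fun js : Fin m × Fin 2 => show
      star (basisVec mθ mφ js.1 js.2) ⬝ᵥ basisVec mθ mφ js.1 js.2 = 1 from isState_basisVec _ _]
    simp
    ring
  have hcorrect : ∀ i, correctProb mθ mφ i (sharedState χ) (readPOVM (g i)) (readPOVM (g i)) =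
      η := by
    intro i
    have h1 : ∀ a : Fin 2, ∀ x, (if g i x = some a ∧ g i x = some a then
        expect (χ x) (verifierProj mθ mφ i a) else 0) = if x = some (i, a) then η / 2 else 0 := by
      intro a x
      rcases x with _ | ⟨j, s⟩
      · simp [g]
      · by_cases hj : j = i
        · subst hj
          by_cases hs : s = a
          · subst hs
            simpa [g] using hsomeV (j, s)
          · simp [g, hs]
        · simp [g, hj]
    simp only [correctProb, expect_sharedState, h1, Finset.sum_ite_eq', Finset.mem_univ, if_true,
      Fin.sum_univ_two]
    ring
  have hadm : ∀ i, Admissible η ξ (sharedState χ) (readPOVM (g i)) (readPOVM (g i)) := by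
    intro i
    have h0 : noPhotonProb (sharedState χ) (readPOVM (g i)) (readPOVM (g i)) = 1 - η := by
      have h1 : ∀ j : Fin m, ∀ s : Fin 2, (if g i (some (j, s)) = none then
          expect (χ (some (j, s))) 1 else 0) = η / 2 - if j = i then η / 2 else 0 := by
        intro j s
        by_cases hj : j = i <;> simp [g, hj, hsome1]
      rw [noPhotonProb, answerProb, expect_sharedState, Fintype.sum_option,
        Fintype.sum_prod_type]
      simp only [and_self, h1]
      simp only [g, Option.elim_none, if_true, hnone1, Finset.sum_const, Finset.card_univ,
        Fintype.card_fin, nsmul_eq_mul, ← Finset.mul_sum, Finset.sum_sub_distrib,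
        Finset.sum_ite_eq', Finset.mem_univ]
      push_cast
      ring
    refine ⟨fun a b hab => ?_, by linarith, by linarith⟩
    rw [answerProb, expect_sharedState]
    refine (Finset.sum_nonpos fun x _ => ?_).trans hξ
    rw [if_neg]
    rintro ⟨rfl, h⟩
    exact hab h
  refine le_trans ?_ (average_pTilde_le_wTilde hη ξ hstate)
  have hm0 : (0 : ℝ) < numBases mθ mφ := by exact_mod_cast numBases_pos mθ mφ
  rw [one_div_mul_eq_div, le_div_iff₀ hm0]
  have h1 : ∀ i, 1 ≤ pTilde mθ mφ η ξ i (sharedState χ) := by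
    intro i
    have := correctProb_le_mul_pTilde hη i hstate (hadm i)
    rw [hcorrect] at this
    exact le_of_mul_le_mul_left (by linarith) hη
  calc (1 : ℝ) * numBases mθ mφ = ∑ _i : Fin (numBases mθ mφ), (1 : ℝ) := by simp
    _ ≤ _ := Finset.sum_le_sum fun i _ => h1 i

end Guessing

/-! ### Chernoff bound and the numerical union bound. -/

section Counting

/-- Chernoff bound for the number of functions that agree with `t` at few points. -/
theorem card_few_hits_le {X : Type*} [Fintype X] [DecidableEq X] {m : ℕ} (t : X → Fin m)
    {s b : ℝ} (hs0 : 0 < s) (hs1 : s ≤ 1) :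
    (Finset.card {f : X → Fin m | (Finset.card {x | f x = t x} : ℝ) < b} : ℝ) * s ^ b ≤
      ((m : ℝ) - 1 + s) ^ Fintype.card X := by
  -- The generating function of the number of hits factorizes over the points: at each one, one
  -- value has weight s and m - 1 have weight 1.
  have hsum : ∑ f : X → Fin m, s ^ (Finset.card {x | f x = t x}) =
      ((m : ℝ) - 1 + s) ^ Fintype.card X := by
    have h1 : ∀ f : X → Fin m, s ^ (Finset.card {x | f x = t x}) =
        ∏ x, if f x = t x then s else 1 := by
      intro f
      rw [Finset.prod_ite, Finset.prod_const, Finset.prod_const_one, mul_one]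
    have h2 : ∀ x, ∑ j : Fin m, (if j = t x then s else 1) = (m : ℝ) - 1 + s := by
      intro x
      have h3 : ∀ j : Fin m, (if j = t x then s else 1) = 1 + if j = t x then s - 1 else 0 := by
        intro j
        split_ifs <;> ring
      simp only [h3, Finset.sum_add_distrib, Finset.sum_ite_eq', Finset.mem_univ, if_true]
      simp
      ring
    simp only [h1]
    rw [← Fintype.piFinset_univ, ← Finset.prod_univ_sum (fun _ => Finset.univ)
      (fun x j => if j = t x then s else 1)]
    simp [h2]
  rw [← hsum, ← nsmul_eq_mul, ← Finset.sum_const]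
  refine (Finset.sum_le_sum fun f hf => ?_).trans
    (Finset.sum_le_sum_of_subset_of_nonneg (Finset.subset_univ _) fun f _ _ => by positivity)
  rw [← Real.rpow_natCast]
  exact Real.rpow_le_rpow_of_exponent_ge hs0 hs1 (Finset.mem_filter.1 hf).2.le

theorem card_few_hits_le_exp {X : Type*} [Fintype X] [DecidableEq X] {m : ℕ} (hm : 0 < m)
    (t : X → Fin m) {s β r : ℝ} (hs0 : 0 < s) (hs1 : s ≤ 1)
    (hr : Real.log (1 - (1 - s) / m) - β * Real.log s ≤ r) :
    (Finset.card {f : X → Fin m | (Finset.card {x | f x = t x} : ℝ) < β * Fintype.card X} : ℝ) ≤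
      (m : ℝ) ^ Fintype.card X * Real.exp (Fintype.card X * r) := by
  have hm0 : (0 : ℝ) < m := by exact_mod_cast hm
  have hm1 : (1 : ℝ) ≤ m := by exact_mod_cast hm
  have hpos : 0 < 1 - (1 - s) / m := by
    rw [sub_pos, div_lt_one hm0]
    linarith
  have h := card_few_hits_le t (b := β * Fintype.card X) hs0 hs1
  rw [← le_div_iff₀ (by positivity)] at h
  refine h.trans ?_
  rw [div_le_iff₀ (by positivity), Real.rpow_def_of_pos hs0, mul_assoc, ← Real.exp_add,
    show (m : ℝ) - 1 + s = m * (1 - (1 - s) / m) by field_simp; ring, mul_pow]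
  gcongr
  rw [← Real.exp_log (pow_pos hpos _), Real.log_pow]
  gcongr
  nlinarith [(Nat.cast_nonneg (Fintype.card X) : (0 : ℝ) ≤ Fintype.card X)]

/-- The optimal tilt is s = β(m - 1)/(1 - β), about 0.598 for m = 5 and β = 0.13. That case is
nearly tight; m = 3 has ample room at the same s. -/
theorem log_rate_le {β : ℝ} {m : ℕ} (h : (m = 3 ∧ β = 0.15) ∨ (m = 5 ∧ β = 0.13)) :
    Real.log (1 - (1 - 0.6) / m) - β * Real.log 0.6 ≤ Real.log 0.1832 / 100 := by
  rcases h with ⟨rfl, rfl⟩ | ⟨rfl, rfl⟩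
  · have h1 : Real.log ((13 / 15 : ℝ) ^ 100) ≤ Real.log (0.6 ^ 15 * 0.1832) :=
      Real.log_le_log (by positivity) (by norm_num)
    rw [Real.log_mul (by norm_num) (by norm_num), Real.log_pow, Real.log_pow] at h1
    push_cast at h1 ⊢
    rw [show (1 : ℝ) - (1 - 0.6) / 3 = 13 / 15 by norm_num]
    linarith
  · have h1 : Real.log ((0.92 : ℝ) ^ 100) ≤ Real.log (0.6 ^ 13 * 0.1832) :=
      Real.log_le_log (by positivity) (by norm_num)
    rw [Real.log_mul (by norm_num) (by norm_num), Real.log_pow, Real.log_pow] at h1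
    push_cast at h1 ⊢
    rw [show (1 : ℝ) - (1 - 0.6) / 5 = 0.92 by norm_num]
    linarith

theorem log_rate_le_neg : Real.log 0.1832 / 100 ≤ -(Real.log 5611 / 512 + 0.00005) := by
  -- Division by 12800 turns 25 into 1/512 and the factor 2 into log 2 / 12800 > 0.00005, the
  -- surplus spent in the count.
  have h1 : Real.log ((0.1832 : ℝ) ^ 128 * 5611 ^ 25 * 2) ≤ Real.log 1 :=
    Real.log_le_log (by positivity) (by norm_num)
  rw [Real.log_mul (by positivity) (by norm_num), Real.log_mul (by positivity) (by positivity),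
    Real.log_pow, Real.log_pow, Real.log_one] at h1
  push_cast at h1
  linarith [Real.log_two_gt_d9]

/-- Put T = 2^n, Q = 4^q, L = log 5611. As 1024 Q ≤ T, the main term 2TQL is at most T²L/512, which
the Chernoff rate cancels. The surplus 0.00005 T² and the gain 2TL from the exponent 4^q - 1 pay for
the sets of kept qubits, the state net and the target 2^(-T). -/
theorem count_mul_exp_le {n q : ℕ} (h : 2 * q + 10 ≤ n) :
    (285716 : ℝ) ^ (4 * 4 ^ q) * ((5611 ^ (4 ^ q - 1) * 2 ^ q) ^ 2 ^ n) ^ 2 *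
      Real.exp (((2 ^ n) ^ 2 : ℝ) * (Real.log 0.1832 / 100)) ≤ 1 / 2 ^ 2 ^ n := by
  have hL0 : 12 * Real.log 2 ≤ Real.log 5611 := by
    have h1 : Real.log ((2 : ℝ) ^ 12) ≤ Real.log 5611 :=
      Real.log_le_log (by positivity) (by norm_num)
    rwa [Real.log_pow] at h1
  have hK : Real.log 285716 ≤ 19 * Real.log 2 := by
    have h1 : Real.log 285716 ≤ Real.log ((2 : ℝ) ^ 19) :=
      Real.log_le_log (by positivity) (by norm_num)
    rwa [Real.log_pow] at h1
  have hrate := log_rate_le_neg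
  have hl2 := Real.log_two_gt_d9
  have hl2' := Real.log_two_lt_d9
  have hQnat : 1 ≤ 4 ^ q := Nat.one_le_pow _ _ (by norm_num)
  -- Tangent-type bound letting a multiple of TQ absorb the cost 2Tq log 2 of the sets of kept
  -- qubits.
  have hQq : (32 : ℝ) * q - 80 ≤ 4 ^ q := by
    have : ∀ k : ℕ, 32 * k ≤ 4 ^ k + 80 := by
      intro k
      induction k with
      | zero => norm_num
      | succ k ih =>
        rw [pow_succ]
        rcases Nat.lt_or_ge k 2 with hk | hk
        · interval_cases k <;> norm_num
        · have : 4 ^ 2 ≤ 4 ^ k := Nat.pow_le_pow_right (by norm_num) hk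
          omega
    have h1 := this q
    have h2 : ((32 * q : ℕ) : ℝ) ≤ ((4 ^ q + 80 : ℕ) : ℝ) := by exact_mod_cast h1
    push_cast at h2
    linarith
  have hTQ : (1024 : ℝ) * 4 ^ q ≤ 2 ^ n := by
    calc (1024 : ℝ) * 4 ^ q = 2 ^ (2 * q + 10) := by
          rw [pow_add, pow_mul]
          norm_num
          ring
      _ ≤ 2 ^ n := pow_le_pow_right₀ (by norm_num) h
  have hexp : (285716 : ℝ) ^ (4 * 4 ^ q) * ((5611 ^ (4 ^ q - 1) * 2 ^ q) ^ 2 ^ n) ^ 2 =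
      Real.exp (4 * 4 ^ q * Real.log 285716 +
        2 * (2 ^ n * ((4 ^ q - 1) * Real.log 5611 + q * Real.log 2))) := by
    rw [← Real.exp_log (show (0 : ℝ) < 285716 ^ (4 * 4 ^ q) *
      ((5611 ^ (4 ^ q - 1) * 2 ^ q) ^ 2 ^ n) ^ 2 by positivity),
      Real.log_mul (by positivity) (by positivity), Real.log_pow, Real.log_pow, Real.log_pow,
      Real.log_mul (by positivity) (by positivity), Real.log_pow, Real.log_pow]
    push_cast [Nat.cast_sub hQnat]
    rfl
  have hright : (1 : ℝ) / 2 ^ 2 ^ n = Real.exp (-(2 ^ n * Real.log 2)) := by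
    rw [Real.exp_neg, one_div, ← Real.exp_log (show (0 : ℝ) < 2 ^ 2 ^ n by positivity),
      Real.log_pow]
    push_cast
    rfl
  rw [hexp, hright, ← Real.exp_add, Real.exp_le_exp]
  set Q : ℝ := 4 ^ q
  set T : ℝ := 2 ^ n
  set L := Real.log 5611
  set K := Real.log 285716
  set l := Real.log 2
  have hQ1 : 1 ≤ Q := one_le_pow₀ (by norm_num)
  have hT1 : 0 < T := by positivity
  have h1 : T ^ 2 * (Real.log 0.1832 / 100) ≤ T ^ 2 * -(L / 512 + 0.00005) := by gcongr
  have h2 : T * (1024 * Q) * (L / 512) ≤ T * T * (L / 512) := by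
    have : 0 ≤ L / 512 := by linarith
    gcongr
  have h3 : 4 * Q * K ≤ 4 * Q * (19 * l) := by gcongr
  have h4 : 4 * Q * (19 * l) ≤ 4 * Q * (19 * 0.7) := by gcongr; linarith
  have h5 : T * (1024 * Q) ≤ T * T := by gcongr
  have h6 : T * (32 * q - 80) ≤ T * Q := by gcongr
  have h7 : T * (12 * 0.693) ≤ T * L := by gcongr; linarith
  have h8 : T * (q * l) ≤ T * (q * 0.694) := by gcongr; linarith
  have h9 : T * l ≤ T * 0.694 := by gcongr; linarith
  have h10 : (0 : ℝ) ≤ T * q := by positivity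
  nlinarith

end Counting

/-! ### Discretized attacks. -/

section Rounding

variable {mθ mφ : ℕ}

theorem pTilde_smul_vec {α β : Type} [Fintype α] [DecidableEq α] [Fintype β] [DecidableEq β]
    (η ξ : ℝ) (i : Fin (numBases mθ mφ)) {z : ℂ} (hz : ‖z‖ = 1) (φ : Fin 2 × (α × β) → ℂ) :
    pTilde mθ mφ η ξ i (z • φ) = pTilde mθ mφ η ξ i φ := by
  simp only [pTilde, Admissible, noPhotonProb, answerProb, correctProb, expect_smul_vec hz]

theorem exists_state_net (q : ℕ) :
    ∃ s : Finset (Fin 2 × (Bits q × Bits q) → ℂ), (∀ φ ∈ s, IsState φ) ∧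
      (s.card : ℝ) ≤ 285716 ^ (4 * 4 ^ q) ∧
      ∀ ψ, IsState ψ → ∃ φ ∈ s, ‖WithLp.toLp 2 (ψ - φ)‖ ≤ 0.000007 := by
  classical
  let E := EuclideanSpace ℂ (Fin 2 × (Bits q × Bits q))
  have hrank : Module.finrank ℝ E = 4 * 4 ^ q := by
    rw [finrank_real_of_complex, finrank_euclideanSpace]
    simp only [Fintype.card_prod, Fintype.card_fin, Fintype.card_pi, Fintype.card_bool,
      Finset.prod_const, Finset.card_univ]
    rw [← mul_pow]
    ring
  obtain ⟨s, hsA, hcard, hs⟩ := exists_net (E := E) (R := 1) (ε := 0.000007) zero_le_one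
    (by norm_num) {x | ‖x‖ = 1} (fun x hx => le_of_eq hx)
  refine ⟨s.image WithLp.ofLp, ?_, ?_, ?_⟩
  · intro φ hφ
    obtain ⟨x, hx, rfl⟩ := Finset.mem_image.1 hφ
    exact isState_iff_norm.2 (hsA hx)
  · refine le_trans (Nat.cast_le.2 Finset.card_image_le) (hcard.trans ?_)
    rw [hrank]
    -- 1 + 2/0.000007 < 285716; similarly 1 + 2π/0.00112 < 5611 for the unitaries.
    gcongr
    norm_num
  · intro ψ hψ
    obtain ⟨x, hx, hd⟩ := hs (WithLp.toLp 2 ψ) (isState_iff_norm.1 hψ)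
    exact ⟨x.ofLp, Finset.mem_image_of_mem _ hx, hd.le⟩

open scoped Matrix.Norms.L2Operator in
theorem exists_unitary_net_bits (q : ℕ) :
    ∃ s : Finset (Matrix.unitaryGroup (Bits q) ℂ), (s.card : ℝ) ≤ 5611 ^ (4 ^ q - 1) ∧
      ∀ U : Matrix.unitaryGroup (Bits q) ℂ, ∃ V ∈ s, ∃ z : ℂ, ‖z‖ = 1 ∧
        ‖(U : Matrix (Bits q) (Bits q) ℂ) - z • (V : Matrix (Bits q) (Bits q) ℂ)‖ ≤ 0.00112 := by
  obtain ⟨s, hcard, hs⟩ := exists_unitary_net (Bits q) (ε := 0.00112) (by norm_num)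
  refine ⟨s, hcard.trans ?_, hs⟩
  have h1 : Fintype.card (Bits q) ^ 2 = 4 ^ q := by
    simp only [Fintype.card_pi, Fintype.card_bool, Finset.prod_const, Finset.card_univ,
      Fintype.card_fin]
    rw [← pow_mul, mul_comm, pow_mul]
    norm_num
  rw [h1]
  have hpi := Real.pi_lt_d6
  have hpi0 := Real.pi_pos
  gcongr
  rw [← le_sub_iff_add_le', div_le_iff₀ (by norm_num)]
  linarith

/-- A discretized attack: a state, and for each input a unitary and the set of qubits to keep. -/
abbrev Rounding (n q : ℕ) (N : Finset (Fin 2 × (Bits q × Bits q) → ℂ))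
    (W : Finset (Matrix.unitaryGroup (Bits q) ℂ)) : Type :=
  N × ((Bits n → W × Finset (Fin q)) × (Bits n → W × Finset (Fin q)))

variable {n q : ℕ} {N : Finset (Fin 2 × (Bits q × Bits q) → ℂ)}
  {W : Finset (Matrix.unitaryGroup (Bits q) ℂ)}

/-- The state of a discretized attack after the exchange. -/
noncomputable def Rounding.exchanged (D : Rounding n q N W) (x y : Bits n) :
    Fin 2 × ((BitsIn (D.2.1 x).2 × BitsOut (D.2.2 y).2) ×
      (BitsOut (D.2.1 x).2 × BitsIn (D.2.2 y).2)) → ℂ :=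
  exchange (D.2.1 x).2 (D.2.2 y).2 (((1 : Matrix (Fin 2) (Fin 2) ℂ) ⊗ₖ
    ((D.2.1 x).1.1.1 ⊗ₖ (D.2.2 y).1.1.1)) *ᵥ D.1.1)

theorem Rounding.isState_exchanged (hN : ∀ φ ∈ N, IsState φ) (D : Rounding n q N W)
    (x y : Bits n) : IsState (D.exchanged x y) :=
  isState_exchange _ _ (isState_local (D.2.1 x).1.1 (D.2.2 y).1.1 (hN _ D.1.2))

theorem card_rounding_le {S u : ℝ} (hN : (N.card : ℝ) ≤ S) (hW : (W.card : ℝ) ≤ u) :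
    (Fintype.card (Rounding n q N W) : ℝ) ≤ S * ((u * 2 ^ q) ^ 2 ^ n) ^ 2 := by
  simp only [Fintype.card_prod, Fintype.card_pi, Finset.prod_const, Finset.card_univ,
    Fintype.card_coe, Fintype.card_finset, Fintype.card_fin, Fintype.card_bool]
  push_cast
  rw [← sq]
  have hS := (Nat.cast_nonneg _).trans hN
  gcongr

theorem Strategy.isState_exchanged (S : Strategy n q) (x y : Bits n) :
    IsState (S.exchanged x y) :=
  isState_exchange _ _ (isState_local _ _ S.isState)

open scoped Matrix.Norms.L2Operator in
/-- Every attack is approximated by a discretized one. -/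
theorem Strategy.exists_rounding {η : ℝ} (hη : 1 / 5 ≤ η) (hN : ∀ φ ∈ N, IsState φ)
    (hNet : ∀ ψ, IsState ψ → ∃ φ ∈ N, ‖WithLp.toLp 2 (ψ - φ)‖ ≤ 0.000007)
    (hW : ∀ U : Matrix.unitaryGroup (Bits q) ℂ, ∃ V ∈ W, ∃ z : ℂ, ‖z‖ = 1 ∧
      ‖(U : Matrix (Bits q) (Bits q) ℂ) - z • (V : Matrix (Bits q) (Bits q) ℂ)‖ ≤ 0.00112)
    (S : Strategy n q) (hS : S.RespondsWith η) :
    ∃ D : Rounding n q N W, ∀ x y (i : Fin (numBases mθ mφ)),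
      correctProb mθ mφ i (S.exchanged x y) (S.povmA x y) (S.povmB x y) ≤
        η * (pTilde mθ mφ η 0.005 i (D.exchanged x y) + 0.009) := by
  obtain ⟨φ, hφ, hφd⟩ := hNet S.state S.isState
  choose V hV z hz hd using hW
  -- The kept sets are copied exactly, so the rounded state lives on the registers on which the
  -- POVMs of `S` act.
  refine ⟨(⟨φ, hφ⟩, (fun x => (⟨V (S.UA x), hV _⟩, S.keepA x),
    fun y => (⟨V (S.UB y), hV _⟩, S.keepB y))), fun x y i => ?_⟩
  set D : Rounding n q N W := (⟨φ, hφ⟩, (fun x => (⟨V (S.UA x), hV _⟩, S.keepA x),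
    fun y => (⟨V (S.UB y), hV _⟩, S.keepB y))) with hD
  have hzz : ‖z (S.UA x) * z (S.UB y)‖ = 1 := by rw [norm_mul, hz, hz, one_mul]
  have hdist := norm_local_sub_le (S.UA x) (V (S.UA x)) (S.UB y) (V (S.UB y)) (hz _) (hz _)
    (hd _) (hd _) S.isState hφd
  rw [← norm_exchange (S.keepA x) (S.keepB y)] at hdist
  have hnear := correctProb_le_of_near hη i (isState_smul hzz (D.isState_exchanged hN x y))
    (S.isState_exchanged x y) (by
      rw [← norm_neg, ← WithLp.toLp_neg, neg_sub]
      refine le_trans (le_of_eq ?_) (hdist.trans (by norm_num))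
      rfl) (hS x y).1 (hS x y).2
  rwa [pTilde_smul_vec _ _ _ hzz] at hnear

end Rounding

/-! ### From many hits to security, and the union bound. -/

section Security

variable {mθ mφ n q : ℕ}

theorem condCorrect_honestProb {η perr : ℝ} (hη : 0 < η) :
    condCorrect (honestProb η perr) = 1 - perr := by
  simp only [condCorrect, honestProb]
  rw [show η * (1 - perr) + η * perr + 0 = η by ring, mul_div_cancel_left₀ _ hη.ne']

/-- This makes the conditioning denominator equal to η for every attack considered. -/
theorem attackProb_total (f : Bits n → Bits n → Fin (numBases mθ mφ)) {η : ℝ}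
    (S : Strategy n q) (hS : S.RespondsWith η) :
    attackProb mθ mφ f S .correct + attackProb mθ mφ f S .wrong + attackProb mθ mφ f S .abort =
      η := by
  simp only [attackProb, ← mul_add, ← Finset.sum_add_distrib]
  have h : ∀ x y, correctProb mθ mφ (f x y) (S.exchanged x y) (S.povmA x y) (S.povmB x y) +
      wrongProb mθ mφ (f x y) (S.exchanged x y) (S.povmA x y) (S.povmB x y) +
      abortProb (S.exchanged x y) (S.povmA x y) (S.povmB x y) = η := by
    intro x y
    have h1 := sum_outcomes (f x y) (S.isState_exchanged x y) (S.povmA x y) (S.povmB x y)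
    linarith [(hS x y).1]
  simp only [h, Finset.sum_const, Finset.card_univ, Fintype.card_pi, Fintype.card_bool,
    Finset.prod_const, Fintype.card_fin, nsmul_eq_mul]
  push_cast
  field_simp
  ring

theorem condNotCorrect_eq (f : Bits n → Bits n → Fin (numBases mθ mφ)) {η : ℝ} (hη : 0 < η)
    (S : Strategy n q) (hS : S.RespondsWith η) :
    condNotCorrect (attackProb mθ mφ f S) = 1 - condCorrect (attackProb mθ mφ f S) := by
  have h := attackProb_total f S hS
  rw [condNotCorrect, condCorrect, h, eq_sub_iff_add_eq, ← add_div, div_eq_one_iff_eq hη.ne']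
  linarith

theorem condCorrect_eq (f : Bits n → Bits n → Fin (numBases mθ mφ)) {η : ℝ}
    (S : Strategy n q) (hS : S.RespondsWith η) :
    condCorrect (attackProb mθ mφ f S) = attackProb mθ mφ f S .correct / η := by
  rw [condCorrect, attackProb_total f S hS]

theorem condNotCorrect_nonneg (f : Bits n → Bits n → Fin (numBases mθ mφ)) {η : ℝ} (hη : 0 < η)
    (S : Strategy n q) (hS : S.RespondsWith η) :
    0 ≤ condNotCorrect (attackProb mθ mφ f S) := by
  rw [condNotCorrect, attackProb_total f S hS]
  have h1 : 0 ≤ attackProb mθ mφ f S .wrong :=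
    mul_nonneg (by positivity) (Finset.sum_nonneg fun x _ => Finset.sum_nonneg fun y _ =>
      wrongProb_nonneg _ _ _ _)
  have h2 : attackProb mθ mφ f S .abort = 0 := by
    simp only [attackProb, fun x y => (hS x y).2, Finset.sum_const_zero, mul_zero]
  rw [h2, add_zero]
  positivity

/-- A function that often hits indices on which a nearby state is not correct is secure. -/
theorem errorBound_le_of_hits {η β ξ Δ : ℝ} (hη : 0 < η)
    (hw : wTilde mθ mφ ξ η + Δ ≤ 1) (f : Bits n → Bits n → Fin (numBases mθ mφ))
    (S : Strategy n q) (hS : S.RespondsWith η) (t : Bits n × Bits n → Fin (numBases mθ mφ))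
    (ht : ∀ x y, correctProb mθ mφ (t (x, y)) (S.exchanged x y) (S.povmA x y) (S.povmB x y) ≤
      η * (wTilde mθ mφ ξ η + Δ))
    (hhits : β * Fintype.card (Bits n × Bits n) ≤
      (Finset.card {p : Bits n × Bits n | f p.1 p.2 = t p} : ℝ)) :
    errorBound mθ mφ β ξ Δ η ≤ condNotCorrect (attackProb mθ mφ f S) := by
  set w := wTilde mθ mφ ξ η + Δ with hwdef
  rw [condNotCorrect_eq f hη S hS, condCorrect_eq f S hS, errorBound, ← hwdef,
    le_sub_comm, div_le_iff₀ hη]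
  have hcard : (Fintype.card (Bits n × Bits n) : ℝ) = 2 ^ (2 * n) := by
    simp only [Fintype.card_prod, Fintype.card_pi, Fintype.card_bool, Finset.prod_const,
      Finset.card_univ, Fintype.card_fin]
    push_cast
    ring
  -- A hit lowers the pointwise bound from η to ηw.
  have hc : ∀ p : Bits n × Bits n, correctProb mθ mφ (f p.1 p.2) (S.exchanged p.1 p.2)
      (S.povmA p.1 p.2) (S.povmB p.1 p.2) ≤ η - if f p.1 p.2 = t p then η * (1 - w) else 0 := by
    rintro ⟨x, y⟩
    split_ifs with h
    · have := ht x y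
      simp only at h
      rw [h]
      linarith
    · have h1 := sum_outcomes (f x y) (S.isState_exchanged x y) (S.povmA x y) (S.povmB x y)
      have h2 := wrongProb_nonneg (f x y) (S.exchanged x y) (S.povmA x y) (S.povmB x y)
      simp only
      linarith [(hS x y).1, (hS x y).2]
  have hsum := Finset.sum_le_sum fun p (_ : p ∈ Finset.univ) => hc p
  rw [Finset.sum_sub_distrib, ← Finset.sum_filter, Finset.sum_const, Finset.sum_const,
    Finset.card_univ, nsmul_eq_mul, nsmul_eq_mul, Fintype.sum_prod_type] at hsum
  have hmul : β * Fintype.card (Bits n × Bits n) * (η * (1 - w)) ≤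
      (Finset.card {p : Bits n × Bits n | f p.1 p.2 = t p} : ℝ) * (η * (1 - w)) := by
    have : 0 ≤ η * (1 - w) := mul_nonneg hη.le (by linarith)
    gcongr
  rw [hcard] at hmul hsum
  rw [attackProb, one_div_mul_eq_div, div_le_iff₀ (by positivity)]
  linarith

theorem ncard_secure_ge {η β : ℝ} (hη : 1 / 5 ≤ η) (hw : wTilde mθ mφ 0.005 η + 0.009 ≤ 1)
    (hβ : (numBases mθ mφ = 3 ∧ β = 0.15) ∨ (numBases mθ mφ = 5 ∧ β = 0.13))
    (hq : 2 * q + 10 ≤ n) :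
    (1 - 1 / (2 : ℝ) ^ (2 ^ n)) * (Nat.card (Bits n → Bits n → Fin (numBases mθ mφ)) : ℝ) ≤
      (Set.ncard {f : Bits n → Bits n → Fin (numBases mθ mφ) |
        ∀ S : Strategy n q, S.RespondsWith η →
          errorBound mθ mφ β 0.005 0.009 η ≤ condNotCorrect (attackProb mθ mφ f S)} : ℝ) := by
  classical
  have hη0 : 0 < η := by linarith
  set m := numBases mθ mφ with hm
  obtain ⟨N, hN, hNcard, hNet⟩ := exists_state_net q
  obtain ⟨W, hWcard, hW⟩ := exists_unitary_net_bits q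
  have hidx : ∀ (D : Rounding n q N W) (p : Bits n × Bits n),
      ∃ i, pTilde mθ mφ η 0.005 i (D.exchanged p.1 p.2) ≤ wTilde mθ mφ 0.005 η :=
    fun D p => exists_pTilde_le_wTilde hη0 _ (D.isState_exchanged hN p.1 p.2)
  -- `t` depends on the rounding alone and is fixed before f, which makes the Chernoff bound
  -- applicable.
  choose t ht using hidx
  set good := {f : Bits n → Bits n → Fin m | ∀ S : Strategy n q, S.RespondsWith η →
    errorBound mθ mφ β 0.005 0.009 η ≤ condNotCorrect (attackProb mθ mφ f S)} with hgood
  let few : Rounding n q N W → Finset (Bits n × Bits n → Fin m) := fun D =>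
    {f | (Finset.card {p | f p = t D p} : ℝ) < β * Fintype.card (Bits n × Bits n)}
  have hbad : goodᶜ ⊆ ((Finset.univ.biUnion few).image Function.curry : Finset _) := by
    intro f hf
    rw [Finset.mem_coe, Finset.mem_image]
    refine ⟨Function.uncurry f, ?_, rfl⟩
    by_contra hfew
    refine hf fun S hS => ?_
    obtain ⟨D, hD⟩ := S.exists_rounding (mθ := mθ) (mφ := mφ) hη hN hNet hW hS
    refine errorBound_le_of_hits hη0 hw f S hS (t D) (fun x y => (hD x y _).trans ?_) ?_
    · have := ht D (x, y)
      gcongr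
    · by_contra! hlt
      exact hfew (Finset.mem_biUnion.2 ⟨D, Finset.mem_univ _, Finset.mem_filter.2
        ⟨Finset.mem_univ _, hlt⟩⟩)
  have hcardX : Fintype.card (Bits n × Bits n) = (2 ^ n) ^ 2 := by
    simp only [Fintype.card_prod, Fintype.card_pi, Fintype.card_bool, Finset.prod_const,
      Finset.card_univ, Fintype.card_fin, sq]
  have hfun : (Nat.card (Bits n → Bits n → Fin m) : ℝ) = (m : ℝ) ^ (2 ^ n) ^ 2 := by
    rw [← Nat.card_congr (Equiv.curry (Bits n) (Bits n) (Fin m)), Nat.card_eq_fintype_card,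
      Fintype.card_fun, hcardX, Fintype.card_fin]
    push_cast
    rfl
  have hbadcard : (goodᶜ.ncard : ℝ) ≤ (m : ℝ) ^ (2 ^ n) ^ 2 * (1 / 2 ^ 2 ^ n) := by
    have h1 : goodᶜ.ncard ≤ (Finset.univ.biUnion few).card := by
      refine (Set.ncard_le_ncard hbad (Finset.finite_toSet _)).trans ?_
      rw [Set.ncard_coe_finset]
      exact Finset.card_image_le
    have h2 : ∀ D, ((few D).card : ℝ) ≤
        (m : ℝ) ^ (2 ^ n) ^ 2 * Real.exp (((2 ^ n) ^ 2 : ℝ) * (Real.log 0.1832 / 100)) := by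
      intro D
      have h3 := card_few_hits_le_exp (numBases_pos mθ mφ) (t D) (s := 0.6) (by norm_num)
        (by norm_num) (log_rate_le hβ)
      rw [hcardX] at h3
      push_cast at h3
      convert h3 using 3
      simp only [few]
      rw [hcardX]
      push_cast
      rfl
    calc (goodᶜ.ncard : ℝ) ≤ ((Finset.univ.biUnion few).card : ℝ) := by exact_mod_cast h1
      _ ≤ ∑ D, ((few D).card : ℝ) := by exact_mod_cast Finset.card_biUnion_le
      _ ≤ ∑ _D : Rounding n q N W,
          (m : ℝ) ^ (2 ^ n) ^ 2 * Real.exp (((2 ^ n) ^ 2 : ℝ) * (Real.log 0.1832 / 100)) :=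
        Finset.sum_le_sum fun D _ => h2 D
      _ = (m : ℝ) ^ (2 ^ n) ^ 2 * (Fintype.card (Rounding n q N W) *
          Real.exp (((2 ^ n) ^ 2 : ℝ) * (Real.log 0.1832 / 100))) := by
        rw [Finset.sum_const, Finset.card_univ, nsmul_eq_mul]
        ring
      _ ≤ _ := by
        gcongr
        refine le_trans ?_ (count_mul_exp_le hq)
        gcongr
        exact card_rounding_le hNcard hWcard
  have htotal : (good.ncard : ℝ) + goodᶜ.ncard = (m : ℝ) ^ (2 ^ n) ^ 2 := by
    rw [← hfun]
    exact_mod_cast Set.ncard_add_ncard_compl good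
  rw [hfun]
  linarith

theorem secure_iff {η β : ℝ} (hη : 0 < η) (f : Bits n → Bits n → Fin (numBases mθ mφ)) :
    (∀ S : Strategy n q, S.RespondsWith η →
      errorBound mθ mφ β 0.005 0.009 η ≤ condNotCorrect (attackProb mθ mφ f S) ∧
        ∀ perr : ℝ, perr < errorBound mθ mφ β 0.005 0.009 η →
          condCorrect (attackProb mθ mφ f S) < condCorrect (honestProb η perr) ∧
            condCorrect (honestProb η perr) = 1 - perr) ↔
    ∀ S : Strategy n q, S.RespondsWith η →
      errorBound mθ mφ β 0.005 0.009 η ≤ condNotCorrect (attackProb mθ mφ f S) := by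
  refine ⟨fun h S hS => (h S hS).1, fun h S hS => ⟨h S hS, fun perr hperr => ?_⟩⟩
  have h1 := h S hS
  rw [condNotCorrect_eq f hη S hS] at h1
  rw [condCorrect_honestProb hη]
  exact ⟨by linarith, rfl⟩

end Security
end QPV

theorem mainTheorem2 (mθ mφ : ℕ) (β : ℝ)
    (hm : (mθ = 2 ∧ mφ = 2 ∧ β = 0.15) ∨ (mθ = 3 ∧ mφ = 2 ∧ β = 0.13))
    (η : ℝ) (hη : QPV.etaThreshold mθ mφ 0.005 0.009 < η) (hη1 : η ≤ 1)
    (n q : ℕ) (hq : (q : ℝ) ≤ (n : ℝ) / 2 - 5) :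
    (1 - 1 / (2 : ℝ) ^ (2 ^ n)) *
        (Nat.card (QPV.Bits n → QPV.Bits n → Fin (QPV.numBases mθ mφ)) : ℝ) ≤
      (Set.ncard {f : QPV.Bits n → QPV.Bits n → Fin (QPV.numBases mθ mφ) |
        ∀ S : QPV.Strategy n q, S.RespondsWith η →
          QPV.errorBound mθ mφ β 0.005 0.009 η ≤
              QPV.condNotCorrect (QPV.attackProb mθ mφ f S) ∧
            ∀ perr : ℝ, perr < QPV.errorBound mθ mφ β 0.005 0.009 η →
              QPV.condCorrect (QPV.attackProb mθ mφ f S) <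
                  QPV.condCorrect (QPV.honestProb η perr) ∧
                QPV.condCorrect (QPV.honestProb η perr) = 1 - perr} : ℝ) := by
  have hη0 : 0 < η := lt_of_le_of_lt (Real.sInf_nonneg fun x hx => hx.1.le) hη
  have hqn : 2 * q + 10 ≤ n := by
    have : ((2 * q + 10 : ℕ) : ℝ) ≤ n := by push_cast; linarith
    exact_mod_cast this
  have hβ : (QPV.numBases mθ mφ = 3 ∧ β = 0.15) ∨ (QPV.numBases mθ mφ = 5 ∧ β = 0.13) := by
    rcases hm with ⟨rfl, rfl, rfl⟩ | ⟨rfl, rfl, rfl⟩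
    exacts [Or.inl ⟨rfl, rfl⟩, Or.inr ⟨rfl, rfl⟩]
  simp only [QPV.secure_iff hη0]
  -- Splitting on the value of `wTilde` at η itself avoids any monotonicity in η.
  rcases le_or_gt (QPV.wTilde mθ mφ 0.005 η + 0.009) 1 with hw | hw
  · refine QPV.ncard_secure_ge ?_ hw hβ hqn
    -- If η < 1/5 then mη ≤ 1 for m = 3 and m = 5, and guessing the basis contradicts `hw`.
    by_contra! hlt
    have h1 : (QPV.numBases mθ mφ : ℝ) * η ≤ 1 := by
      rcases hβ with ⟨h, -⟩ | ⟨h, -⟩ <;> rw [h] <;> push_cast <;> linarith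
    have := QPV.one_le_wTilde (ξ := 0.005) hη0 (by norm_num) h1
    linarith
  · have huniv : {f : QPV.Bits n → QPV.Bits n → Fin (QPV.numBases mθ mφ) |
        ∀ S : QPV.Strategy n q, S.RespondsWith η →
          QPV.errorBound mθ mφ β 0.005 0.009 η ≤
            QPV.condNotCorrect (QPV.attackProb mθ mφ f S)} = Set.univ := by
      refine Set.eq_univ_of_forall fun f S hS => ?_
      refine le_trans ?_ (QPV.condNotCorrect_nonneg f hη0 S hS)
      have hβ0 : 0 ≤ β := by rcases hβ with ⟨-, rfl⟩ | ⟨-, rfl⟩ <;> norm_num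
      exact mul_nonpos_of_nonneg_of_nonpos hβ0 (by linarith)
    rw [huniv, Set.ncard_univ]
    refine mul_le_of_le_one_left (by positivity) ?_
    have : (0 : ℝ) ≤ 1 / 2 ^ 2 ^ n := by positivity
    linarith
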